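/- Let $k$ be a field of characteristic different from $2$ and let $n\ge 1$. Let $B_n=S_n\ltimes\mathbb{Z}_2^n$ be the group of signed permutations of $\{\pm1,\dots,\pm n\}$, and let $\varphi:kB_n\to kS_n$ be the linear extension of the projection $B_n\to S_n$ that forgets the signs. For a signed or ordinary permutation $\sigma$ put $\sigma(0)=0$. Let $$\mathrm{Des}(\sigma)=\{i\in\{0,\dots,n-1\}:\sigma(i)>\sigma(i+1)\}\quad(\sigma\in B_n),$$ $$\mathrm{Peak}(\sigma)=\{i\in\{1,\dots,n-1\}:\sigma(i-1)<\sigma(i)>\sigma(i+1)\}\quad(\sigma\in S_n).$$ Let $y_j$ and $y^0_j$ be the sums in $kB_n$ of all $\sigma\in B_n$ with $\#\mathrm{Des}(\sigma)=j$, respectively with $\#(\mathrm{Des}(\sigma)\setminus\{0\})=j-1$. Let $p_j$ and $p^0_j$ be the sums in $kS_n$ of all $\sigma\in S_n$ with $\#\mathrm{Peak}(\sigma)=j$, respectively with $\#(\mathrm{Peak}(\sigma)\setminus\{1\})=j-1$. Let $m!!=m(m-2)(m-4)\cdots$, ending in $2$ or $1$, for $m\ge1$, and $0!!=(-1)!!=1$.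 Define $$e_{(n)}=\sum_{j=0}^n(-1)^j\frac{(2j-1)!!\,(2n-2j-1)!!}{(2n)!!}\,y_j,\qquad e_{(0,n)}=\sum_{j=1}^n(-1)^{j-1}\frac{(j-1)!\,(n-j)!}{n!}\,y^0_j,$$ $$\rho_{(n)}=\sum_{j=0}^{\lfloor n/2\rfloor}(-1)^j\frac{(2j-1)!!\,(n-2j-1)!!}{n!!}\,p_j,\qquad \rho_{(0,n)}=\sum_{j=1}^{\lfloor (n+1)/2\rfloor}(-1)^{j-1}\frac{(2j-2)!!\,(n-2j)!!}{n!!}\,p^0_j.$$ (i) If $(2n)!!\neq0$ in $k$, then $\varphi(e_{(n)})=\rho_{(n)}$ when $n$ is even and $\varphi(e_{(n)})=0$ when $n$ is odd. (ii) If $n!\neq0$ in $k$, then $\varphi(e_{(0,n)})=0$ when $n$ is even and $\varphi(e_{(0,n)})=2\rho_{(0,n)}$ when $n$ is odd. (iii) If $n!!\neq0$ in $k$, then $\rho_{(n)}$ is idempotent in $kS_n$ when $n$ is even, and $\rho_{(0,n)}$ is idempotent in $kS_n$ when $n$ is odd. The nonvanishing conditions say only that the coefficients above are defined in $k$; they all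 hold when $k$ has characteristic $0$ or characteristic greater than $n$. -/

import Mathlib

open scoped Nat

namespace PeakAlgebra

/-- The group `B_n` of signed permutations, as the semidirect product of the sign vectors
`{1,-1}^n` with `S_n`, where `S_n` acts by permuting the coordinates.  The pair `(ε, π)`
is the signed permutation `i ↦ ε (π i) * π i`; see `signedValue`. -/
abbrev SignedPerm (n : ℕ) : Type :=
  SemidirectProduct (Fin n → ℤˣ) (Equiv.Perm (Fin n))
    (mulAutArrow : Equiv.Perm (Fin n) →* MulAut (Fin n → ℤˣ))

instance instFintypeSignedPerm (n : ℕ) : Fintype (SignedPerm n) :=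
  Fintype.ofEquiv ((Fin n → ℤˣ) × Equiv.Perm (Fin n)) SemidirectProduct.equivProd.symm

/-- The value `σ(i)` of an ordinary permutation, in the one-based convention:
`σ(i) ∈ {1,…,n}` for `1 ≤ i ≤ n`, and `σ(0) = 0`.  (The value for `i > n` is never used.) -/
def value {n : ℕ} (σ : Equiv.Perm (Fin n)) (i : ℕ) : ℤ :=
  if h : 1 ≤ i ∧ i ≤ n then ((σ ⟨i - 1, by omega⟩ : ℕ) : ℤ) + 1 else 0

/-- The value `σ(i)` of a signed permutation, in the one-based convention:
`σ(i) ∈ {±1,…,±n}` for `1 ≤ i ≤ n`, and `σ(0) = 0`. -/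
def signedValue {n : ℕ} (σ : SignedPerm n) (i : ℕ) : ℤ :=
  if h : 1 ≤ i ∧ i ≤ n then
    (σ.left (σ.right ⟨i - 1, by omega⟩) : ℤ) * (((σ.right ⟨i - 1, by omega⟩ : ℕ) : ℤ) + 1)
  else 0

/-- `Des(σ) ⊆ [0, n-1]` for a signed permutation `σ`. -/
def signedDes {n : ℕ} (σ : SignedPerm n) : Finset ℕ :=
  {i ∈ Finset.range n | signedValue σ i > signedValue σ (i + 1)}

/-- `Peak(σ) ⊆ [n-1]` for an ordinary permutation `σ`; a peak at `1` is allowed. -/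
def peakSet {n : ℕ} (σ : Equiv.Perm (Fin n)) : Finset ℕ :=
  {i ∈ Finset.Ico 1 n | value σ (i - 1) < value σ i ∧ value σ i > value σ (i + 1)}

noncomputable section

/-- The linear extension `k B_n → k S_n` of the projection `B_n → S_n` forgetting the signs. -/
def forgetSigns (k : Type*) [Field k] (n : ℕ) :
    MonoidAlgebra k (SignedPerm n) →ₐ[k] MonoidAlgebra k (Equiv.Perm (Fin n)) :=
  MonoidAlgebra.mapDomainAlgHom k k SemidirectProduct.rightHom

/-- `y_j`: the sum of the signed permutations with exactly `j` descents. -/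
def y (k : Type*) [Field k] (n j : ℕ) : MonoidAlgebra k (SignedPerm n) :=
  ∑ σ : SignedPerm n with (signedDes σ).card = j, MonoidAlgebra.of k (SignedPerm n) σ

/-- `y⁰_j` (for `j ≥ 1`): the sum of the signed permutations with exactly `j - 1`
descents other than `0`. -/
def y0 (k : Type*) [Field k] (n j : ℕ) : MonoidAlgebra k (SignedPerm n) :=
  ∑ σ : SignedPerm n with (signedDes σ \ {0}).card + 1 = j, MonoidAlgebra.of k (SignedPerm n) σ

/-- `p_j`: the sum of the permutations with exactly `j` peaks. -/
def p (k : Type*) [Field k] (n j : ℕ) : MonoidAlgebra k (Equiv.Perm (Fin n)) :=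
  ∑ σ : Equiv.Perm (Fin n) with (peakSet σ).card = j,
    MonoidAlgebra.of k (Equiv.Perm (Fin n)) σ

/-- `p⁰_j` (for `j ≥ 1`): the sum of the permutations with exactly `j - 1` peaks
other than `1`. -/
def p0 (k : Type*) [Field k] (n j : ℕ) : MonoidAlgebra k (Equiv.Perm (Fin n)) :=
  ∑ σ : Equiv.Perm (Fin n) with (peakSet σ \ {1}).card + 1 = j,
    MonoidAlgebra.of k (Equiv.Perm (Fin n)) σ

/-! In the four elements below, the argument of every double factorial and factorial is at
least `-1` as an integer, and it is `-1` only for double factorials.  There the truncated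
subtraction gives `0‼ = 1`, which agrees with the convention `(-1)!! = 0!! = 1`. -/

/-- The element `e_(n)`. -/
def e (k : Type*) [Field k] (n : ℕ) : MonoidAlgebra k (SignedPerm n) :=
  ∑ j ∈ Finset.Icc 0 n,
    ((-1 : k) ^ j * (((2 * j - 1)‼ : ℕ) : k) * (((2 * n - 2 * j - 1)‼ : ℕ) : k)
      / (((2 * n)‼ : ℕ) : k)) • y k n j

/-- The element `e_(0,n)`. -/
def e0 (k : Type*) [Field k] (n : ℕ) : MonoidAlgebra k (SignedPerm n) :=
  ∑ j ∈ Finset.Icc 1 n,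
    ((-1 : k) ^ (j - 1) * (((j - 1)! : ℕ) : k) * (((n - j)! : ℕ) : k)
      / ((n ! : ℕ) : k)) • y0 k n j

/-- The element `ρ_(n)`. -/
def rho (k : Type*) [Field k] (n : ℕ) : MonoidAlgebra k (Equiv.Perm (Fin n)) :=
  ∑ j ∈ Finset.Icc 0 (n / 2),
    ((-1 : k) ^ j * (((2 * j - 1)‼ : ℕ) : k) * (((n - 2 * j - 1)‼ : ℕ) : k)
      / ((n‼ : ℕ) : k)) • p k n j

/-- The element `ρ_(0,n)`. -/
def rho0 (k : Type*) [Field k] (n : ℕ) : MonoidAlgebra k (Equiv.Perm (Fin n)) :=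
  ∑ j ∈ Finset.Icc 1 ((n + 1) / 2),
    ((-1 : k) ^ (j - 1) * (((2 * j - 2)‼ : ℕ) : k) * (((n - 2 * j)‼ : ℕ) : k)
      / ((n‼ : ℕ) : k)) • p0 k n j

end

end PeakAlgebra

namespace PeakAlgebra

/-! Fix `π` in `S_n` and sum over its `2^n` signings. Whether a step between neighbours is a descent
depends only on the sign of the entry of larger absolute value, so the sum of `X^des * Y^(n - des)`
factors over positions and equals `(4XY)^peak * (X+Y)^(n - 2 peak)` (`sum_descents`;
`sum_descents_sdiff_zero` is the analogue that ignores the step at 0). For `X = -sin² x`, `Y = cos²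
x` one has `X + Y = cos 2x` and `4XY = -sin² 2x`. Up to a common constant and signs, the
coefficients of `e` are the integrals of `sin^(2d) cos^(2(n-d))` over the first quadrant, so
integrating this identity turns the coefficients of `e` into those of `rho`. An odd power of `cos
2x` integrates to zero, whence the dependence on the parity of `n`. For `e0` the integrand carries
an extra factor `sin x cos x`.

Idempotency is proved upstairs, in the group algebra of `B_n` over `ℚ`. Let `W_m` be the sum of the
standardizations of all words of length `n` over a symmetric alphabet of `m` letters. Combining
letters as digits gives `W_p W_q = W_(pq)` (`wordSum_mul`). The coefficient of `σ` in `W_(2x+1)` or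
`W_(2x)` is a binomial coefficient (`card_std_eq`), hence polynomial in `x`, so the product rules
hold for all rational parameters (`mul_rule_extend`). The point `x = -1/2`, that is `m = 0`, yields
`e² = e`; the value of `W_(2x)/x` at `x = 0` is `e0`, and the rule there reads `e0² = 2 e0`.
Forgetting signs gives the idempotency of `rho` and `rho0` over `ℚ`. Both have integral numerators
over `n‼`, so it passes to every field where `n‼ ≠ 0` (`isIdempotentElem_of_rat`). -/

/-! ### Trigonometric integrals and double factorials -/

/-- The integral of `sin ^ a * cos ^ b` over the first quadrant. -/
noncomputable def trigIntegral (a b : ℕ) : ℝ :=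
  ∫ x in (0 : ℝ)..(Real.pi / 2), Real.sin x ^ a * Real.cos x ^ b

theorem trigIntegral_eq_add (a b : ℕ) :
    trigIntegral a b = trigIntegral (a + 2) b + trigIntegral a (b + 2) := by
  unfold trigIntegral
  rw [← intervalIntegral.integral_add (Continuous.intervalIntegrable (by fun_prop) _ _)
    (Continuous.intervalIntegrable (by fun_prop) _ _)]
  congr 1
  ext x
  linear_combination (-(Real.sin x ^ a * Real.cos x ^ b)) * Real.sin_sq_add_cos_sq x

theorem trigIntegral_by_parts (a b : ℕ) :
    (a + 1) * trigIntegral a (b + 2) = (b + 1) * trigIntegral (a + 2) b := by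
  have h := intervalIntegral.integral_eq_sub_of_hasDerivAt (a := 0) (b := Real.pi / 2)
    (f := fun x => Real.sin x ^ (a + 1) * Real.cos x ^ (b + 1))
    (f' := fun x => (a + 1) * (Real.sin x ^ a * Real.cos x ^ (b + 2)) -
      (b + 1) * (Real.sin x ^ (a + 2) * Real.cos x ^ b))
    (fun x _ => by
      refine (((Real.hasDerivAt_sin x).pow (a + 1)).mul
        ((Real.hasDerivAt_cos x).pow (b + 1))).congr_deriv ?_
      push_cast
      simp only [Pi.pow_apply]
      ring)
    (Continuous.intervalIntegrable (by fun_prop) _ _)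
  rw [intervalIntegral.integral_sub (Continuous.intervalIntegrable (by fun_prop) _ _)
    (Continuous.intervalIntegrable (by fun_prop) _ _), intervalIntegral.integral_const_mul,
    intervalIntegral.integral_const_mul] at h
  simp only [Real.cos_pi_div_two, Real.sin_zero, zero_pow (Nat.succ_ne_zero _), mul_zero,
    zero_mul, sub_zero] at h
  exact sub_eq_zero.1 h

theorem trigIntegral_comm (a b : ℕ) : trigIntegral a b = trigIntegral b a := by
  unfold trigIntegral
  have h := intervalIntegral.integral_comp_sub_left (a := 0) (b := Real.pi / 2)
    (fun x => Real.sin x ^ a * Real.cos x ^ b) (Real.pi / 2)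
  simp only [sub_self, sub_zero, Real.sin_pi_div_two_sub, Real.cos_pi_div_two_sub] at h
  rw [← h]
  simp only [mul_comm]

theorem trigIntegral_step (a b : ℕ) :
    (a + b + 2) * trigIntegral a (b + 2) = (b + 1) * trigIntegral a b := by
  linear_combination trigIntegral_by_parts a b - (b + 1 : ℝ) * trigIntegral_eq_add a b

theorem doubleFactorial_add_one_eq (b : ℕ) : (b + 1)‼ = (b + 1) * (b - 1)‼ := by
  cases b with
  | zero => rfl
  | succ b => rw [Nat.doubleFactorial_add_two]; rfl

/-- `trigIntegral_step` lowers an exponent by 2 and the symmetry in `a`, `b` covers the other one,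
leaving exponents in `{0, 1}`. At exponent 0 truncation gives `0‼ = 1`, which is the right value of
`(-1)!!`. -/
theorem trigIntegral_eq (a b : ℕ) :
    trigIntegral a b * ((a + b)‼ : ℕ) =
      (if Even a ∧ Even b then Real.pi / 2 else 1) * ((a - 1)‼ : ℕ) * ((b - 1)‼ : ℕ) := by
  have step : ∀ a b : ℕ, trigIntegral a b * ((a + b)‼ : ℕ) =
      (if Even a ∧ Even b then Real.pi / 2 else 1) * ((a - 1)‼ : ℕ) * ((b - 1)‼ : ℕ) →
      trigIntegral a (b + 2) * ((a + (b + 2))‼ : ℕ) =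
      (if Even a ∧ Even (b + 2) then Real.pi / 2 else 1) * ((a - 1)‼ : ℕ) *
        ((b + 2 - 1)‼ : ℕ) := by
    intro a b h
    have e1 : Even (b + 2) ↔ Even b := by simp [Nat.even_add]
    simp only [e1]
    rw [← add_assoc, Nat.doubleFactorial_add_two, show b + 2 - 1 = b + 1 from rfl,
      doubleFactorial_add_one_eq b]
    push_cast
    linear_combination ((a + b)‼ : ℝ) * trigIntegral_step a b + (b + 1 : ℝ) * h
  have swap : ∀ a b : ℕ, trigIntegral a b * ((a + b)‼ : ℕ) =
      (if Even a ∧ Even b then Real.pi / 2 else 1) * ((a - 1)‼ : ℕ) * ((b - 1)‼ : ℕ) →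
      trigIntegral b a * ((b + a)‼ : ℕ) =
      (if Even b ∧ Even a then Real.pi / 2 else 1) * ((b - 1)‼ : ℕ) * ((a - 1)‼ : ℕ) := by
    intro a b h
    rw [trigIntegral_comm, add_comm b a, h, if_congr and_comm rfl rfl]
    ring
  have t00 : trigIntegral 0 0 = Real.pi / 2 := by simp [trigIntegral]
  have t10 : trigIntegral 1 0 = 1 := by simp [trigIntegral]
  have t11 : trigIntegral 1 1 = 1 / 2 := by
    simp only [trigIntegral, pow_one]
    rw [integral_sin_mul_cos₁]
    norm_num
  have base : ∀ a, (∀ b < 2, trigIntegral a b * ((a + b)‼ : ℕ) =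
      (if Even a ∧ Even b then Real.pi / 2 else 1) * ((a - 1)‼ : ℕ) * ((b - 1)‼ : ℕ)) →
      ∀ b, trigIntegral a b * ((a + b)‼ : ℕ) =
      (if Even a ∧ Even b then Real.pi / 2 else 1) * ((a - 1)‼ : ℕ) * ((b - 1)‼ : ℕ) := by
    intro a h b
    induction b using Nat.twoStepInduction with
    | zero => exact h 0 (by norm_num)
    | one => exact h 1 (by norm_num)
    | more b h1 _ => exact step a b h1
  have b0 := base 0 (fun b hb => by
    interval_cases b
    · simp [t00]
    · simp [trigIntegral_comm 0 1, t10])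
  have b1 := base 1 (fun b hb => by
    interval_cases b
    · simp [t10]
    · simp [t11, Nat.doubleFactorial])
  exact base a (fun c hc => by
    interval_cases c
    · exact swap _ _ (b0 a)
    · exact swap _ _ (b1 a)) b

/-- Doubling the angle stretches the range to `[0, π]`; reflection in `π/2` changes the sign of the
cosine, so the two halves cancel when `b` is odd and agree when `b` is even. -/
theorem integral_sin_pow_mul_cos_pow_double (a b : ℕ) :
    ∫ x in (0 : ℝ)..(Real.pi / 2), Real.sin (2 * x) ^ a * Real.cos (2 * x) ^ b =
      (1 + (-1) ^ b) / 2 * trigIntegral a b := by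
  have h := intervalIntegral.integral_comp_mul_left (a := 0) (b := Real.pi / 2)
    (fun x => Real.sin x ^ a * Real.cos x ^ b) (two_ne_zero (α := ℝ))
  have h2 := intervalIntegral.integral_comp_sub_left (a := 0) (b := Real.pi / 2)
    (fun x => Real.sin x ^ a * Real.cos x ^ b) Real.pi
  have h3 := intervalIntegral.integral_add_adjacent_intervals (a := 0) (b := Real.pi / 2)
    (c := Real.pi) (μ := MeasureTheory.volume)
    (f := fun x => Real.sin x ^ a * Real.cos x ^ b)
    (Continuous.intervalIntegrable (by fun_prop) _ _)
    (Continuous.intervalIntegrable (by fun_prop) _ _)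
  rw [h, mul_zero, show 2 * (Real.pi / 2) = Real.pi by ring, ← h3]
  rw [show Real.pi - Real.pi / 2 = Real.pi / 2 by ring, sub_zero] at h2
  rw [← h2]
  have e1 : ∀ x : ℝ, Real.sin (Real.pi - x) ^ a * Real.cos (Real.pi - x) ^ b =
      (-1) ^ b * (Real.sin x ^ a * Real.cos x ^ b) := by
    intro x
    rw [Real.sin_pi_sub, Real.cos_pi_sub, neg_pow]
    ring
  simp only [e1, intervalIntegral.integral_const_mul, smul_eq_mul]
  unfold trigIntegral
  ring

/-! ### Descents summed over the signings of one permutation -/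

/-- The entries of a sign vector in the one-based convention, extended by `1`. -/
def signAt {n : ℕ} (s : Fin n → ℤˣ) (i : ℕ) : ℤˣ :=
  if h : 1 ≤ i ∧ i ≤ n then s ⟨i - 1, by omega⟩ else 1

theorem signedValue_eq {n : ℕ} (σ : SignedPerm n) (i : ℕ) :
    signedValue σ i = signAt (fun j => σ.left (σ.right j)) i * value σ.right i := by
  unfold signedValue signAt value
  split_ifs <;> simp

theorem value_nonneg {n : ℕ} (π : Equiv.Perm (Fin n)) (i : ℕ) : 0 ≤ value π i := by
  unfold value
  split_ifs <;> positivity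

theorem value_pos {n : ℕ} (π : Equiv.Perm (Fin n)) {i : ℕ} (h : 1 ≤ i) (h' : i ≤ n) :
    0 < value π i := by
  unfold value
  rw [dif_pos ⟨h, h'⟩]
  positivity

theorem value_zero {n : ℕ} (π : Equiv.Perm (Fin n)) : value π 0 = 0 := by
  simp [value]

theorem value_ne {n : ℕ} (π : Equiv.Perm (Fin n)) {i : ℕ} (h : i < n) :
    value π i ≠ value π (i + 1) := by
  rcases Nat.eq_zero_or_pos i with rfl | hi
  · rw [value_zero]
    exact (value_pos π le_rfl h).ne
  · unfold value
    rw [dif_pos ⟨hi, h.le⟩, dif_pos ⟨by omega, h⟩]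
    intro e
    have e1 : π ⟨i - 1, by omega⟩ = π ⟨i + 1 - 1, by omega⟩ := by
      apply Fin.ext
      omega
    have := congrArg Fin.val (π.injective e1)
    simp only at this
    omega

/-- The entry of larger absolute value decides the comparison, so only its sign matters. This is
what makes the sum over signs factor. -/
theorem signedValue_gt_iff {n : ℕ} (σ : SignedPerm n) {i : ℕ} (h : i < n) :
    signedValue σ i > signedValue σ (i + 1) ↔
      if value σ.right i < value σ.right (i + 1) then
        signAt (fun j => σ.left (σ.right j)) (i + 1) = -1
      else signAt (fun j => σ.left (σ.right j)) i = 1 := by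
  rw [signedValue_eq, signedValue_eq]
  have h0 := value_nonneg σ.right i
  have h1 := value_pos σ.right (Nat.le_add_left 1 i) h
  have h2 := value_ne σ.right h
  have e1 : (1 : ℤˣ) ≠ -1 := by decide
  rcases Int.units_eq_one_or (signAt (fun j => σ.left (σ.right j)) (i + 1)) with h3 | h3 <;>
  rcases Int.units_eq_one_or (signAt (fun j => σ.left (σ.right j)) i) with h4 | h4 <;>
  rw [h3, h4] <;> split_ifs with h5 <;> simp [e1, e1.symm] <;> omega

/-- The contribution of a position whose left and right steps are ascents or not. -/
def stepFactor {R : Type*} [CommRing R] (X Y : R) (a b : Prop) [Decidable a] [Decidable b] : R :=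
  if a then (if b then X + Y else 2 * (X * Y)) else (if b then 2 else X + Y)

theorem signAt_succ {n : ℕ} (s : Fin n → ℤˣ) (i : Fin n) : signAt s (i + 1) = s i := by
  unfold signAt
  rw [dif_pos ⟨by omega, i.2⟩]
  rfl

/-- Every step is charged to its larger end, so the weights can be regrouped by position: a position
receives its left step if that ascends and its right step if that descends. Each factor then
involves a single sign, and the sum of products becomes a product of two-term sums. -/
theorem sum_prod_steps {R : Type*} [CommRing R] (X Y : R) (n : ℕ) (A : ℕ → Prop)
    [DecidablePred A] (hn : A n) :
    ∑ s : Fin n → ℤˣ, ∏ i ∈ Finset.range n,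
      (if A i then (if signAt s (i + 1) = -1 then X else Y)
        else if i = 0 then 1 else if signAt s i = 1 then X else Y) =
    ∏ i ∈ Finset.range n, stepFactor X Y (A i) (A (i + 1)) := by
  have key : ∀ s : Fin n → ℤˣ, ∏ i ∈ Finset.range n,
      (if A i then (if signAt s (i + 1) = -1 then X else Y)
        else if i = 0 then 1 else if signAt s i = 1 then X else Y) =
      ∏ i : Fin n, ((if A i then (if s i = -1 then X else Y) else 1) *
        (if A (i + 1) then 1 else if s i = 1 then X else Y)) := by
    intro s
    -- Weights of the descending steps. They equal 1 at both ends, so the index may be shifted by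
    -- one.
    let B : ℕ → R := fun i =>
      if A i then 1 else if i = 0 then 1 else if signAt s i = 1 then X else Y
    have hB : ∏ i ∈ Finset.range n, B i = ∏ i ∈ Finset.range n, B (i + 1) := by
      have h1 := Finset.prod_range_succ B n
      have h2 := Finset.prod_range_succ' B n
      have b0 : B 0 = 1 := by simp [B]
      have bn : B n = 1 := by simp [B, hn]
      rw [b0, mul_one] at h2
      rw [bn, mul_one] at h1
      rw [← h1, h2]
    calc _ = ∏ i ∈ Finset.range n,
          ((if A i then (if signAt s (i + 1) = -1 then X else Y) else 1) * B i) := by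
            refine Finset.prod_congr rfl fun i _ => ?_
            by_cases h : A i <;> simp [h, B]
      _ = ∏ i ∈ Finset.range n,
          ((if A i then (if signAt s (i + 1) = -1 then X else Y) else 1) * B (i + 1)) := by
            rw [Finset.prod_mul_distrib, hB, Finset.prod_mul_distrib]
      _ = _ := by
            rw [Finset.prod_range]
            refine Finset.prod_congr rfl fun i _ => ?_
            simp [B, signAt_succ]
  simp_rw [key]
  rw [Finset.prod_range, ← Fintype.piFinset_univ, ← Finset.prod_univ_sum
    (fun _ => Finset.univ) (fun (i : Fin n) (t : ℤˣ) =>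
      (if A i then (if t = -1 then X else Y) else 1) *
        (if A (i + 1) then 1 else if t = 1 then X else Y))]
  refine Finset.prod_congr rfl fun i _ => ?_
  have hu : (Finset.univ : Finset ℤˣ) = {1, -1} := by decide
  have e1 : (1 : ℤˣ) ≠ -1 := by decide
  rw [hu, Finset.sum_pair e1]
  unfold stepFactor
  by_cases h : A i <;> by_cases h' : A (i + 1) <;> simp [h, h', e1, e1.symm] <;> ring

/-- A peak contributes `2XY`, a valley `2`, any other position `X + Y`. Starting from an ascent,
peaks and valleys alternate beginning with a peak: valleys match peaks if the last step ascends, and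
are one short otherwise, hence the factor 2 on the left in that case. The exponent `r` counts the
remaining positions. -/
theorem prod_stepFactor {R : Type*} [CommRing R] (X Y : R) (A : ℕ → Prop) [DecidablePred A]
    (h0 : A 0) (n : ℕ) :
    ∃ r, (if A n then
      n = 2 * ((Finset.range n).filter fun i => A i ∧ ¬ A (i + 1)).card + r ∧
      ∏ i ∈ Finset.range n, stepFactor X Y (A i) (A (i + 1)) =
        (4 * (X * Y)) ^ ((Finset.range n).filter fun i => A i ∧ ¬ A (i + 1)).card * (X + Y) ^ r
      else n + 1 = 2 * ((Finset.range n).filter fun i => A i ∧ ¬ A (i + 1)).card + r ∧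
      2 * ∏ i ∈ Finset.range n, stepFactor X Y (A i) (A (i + 1)) =
        (4 * (X * Y)) ^ ((Finset.range n).filter fun i => A i ∧ ¬ A (i + 1)).card *
          (X + Y) ^ r) := by
  induction n with
  | zero => exact ⟨0, by simp [h0]⟩
  | succ n ih =>
    obtain ⟨r, hr⟩ := ih
    rw [Finset.range_add_one, Finset.filter_insert, Finset.prod_insert (by simp)]
    by_cases h : A n <;> by_cases h' : A (n + 1) <;>
      simp only [h, h', if_true, if_false, not_true, not_false_eq_true, and_true, and_false,
        stepFactor] at hr ⊢
    · exact ⟨r + 1, by omega, by rw [hr.2]; ring⟩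
    · rw [Finset.card_insert_of_notMem (by simp)]
      exact ⟨r, by omega, by rw [hr.2]; ring⟩
    · exact ⟨r, by omega, hr.2⟩
    · exact ⟨r + 1, by omega, by linear_combination (X + Y) * hr.2⟩

/-- Starting from a descent, the first turning point is a valley, so a final ascent leaves one
valley unpaired; it supplies the extra factor 2. -/
theorem prod_stepFactor' {R : Type*} [CommRing R] (X Y : R) (A : ℕ → Prop) [DecidablePred A]
    (h0 : ¬ A 0) (n : ℕ) :
    ∃ r, (if A n then
      n = 2 * ((Finset.range n).filter fun i => A i ∧ ¬ A (i + 1)).card + 1 + r ∧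
      ∏ i ∈ Finset.range n, stepFactor X Y (A i) (A (i + 1)) =
        2 * (4 * (X * Y)) ^ ((Finset.range n).filter fun i => A i ∧ ¬ A (i + 1)).card *
          (X + Y) ^ r
      else n = 2 * ((Finset.range n).filter fun i => A i ∧ ¬ A (i + 1)).card + r ∧
      ∏ i ∈ Finset.range n, stepFactor X Y (A i) (A (i + 1)) =
        (4 * (X * Y)) ^ ((Finset.range n).filter fun i => A i ∧ ¬ A (i + 1)).card *
          (X + Y) ^ r) := by
  induction n with
  | zero => exact ⟨0, by simp [h0]⟩
  | succ n ih =>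
    obtain ⟨r, hr⟩ := ih
    rw [Finset.range_add_one, Finset.filter_insert, Finset.prod_insert (by simp)]
    by_cases h : A n <;> by_cases h' : A (n + 1) <;>
      simp only [h, h', if_true, if_false, not_true, not_false_eq_true, and_true, and_false,
        stepFactor] at hr ⊢
    · exact ⟨r + 1, by omega, by rw [hr.2]; ring⟩
    · rw [Finset.card_insert_of_notMem (by simp)]
      exact ⟨r, by omega, by rw [hr.2]; ring⟩
    · exact ⟨r, by omega, by rw [hr.2]; ring⟩
    · exact ⟨r + 1, by omega, by rw [hr.2]; ring⟩

theorem sum_signs_reindex {n : ℕ} {R : Type*} [AddCommMonoid R] (π : Equiv.Perm (Fin n))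
    (F : (Fin n → ℤˣ) → R) :
    ∑ ε : Fin n → ℤˣ, F (fun j => ε (π j)) = ∑ s, F s :=
  Fintype.sum_equiv (Equiv.arrowCongr π.symm (Equiv.refl _)) _ _ fun _ => rfl

theorem pow_card_filter_mul {R : Type*} [CommRing R] (X Y : R) (s : Finset ℕ) (P : ℕ → Prop)
    [DecidablePred P] :
    X ^ (s.filter P).card * Y ^ (s.card - (s.filter P).card) =
      ∏ i ∈ s, if P i then X else Y := by
  rw [Finset.prod_ite, Finset.prod_const, Finset.prod_const]
  congr 2
  have := Finset.card_filter_add_card_filter_not (s := s) P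
  omega

theorem sum_descents {R : Type*} [CommRing R] (X Y : R) {n : ℕ} (π : Equiv.Perm (Fin n)) :
    ∃ r, n = 2 * (peakSet π).card + r ∧
      ∑ ε : Fin n → ℤˣ, X ^ (signedDes ⟨ε, π⟩).card * Y ^ (n - (signedDes ⟨ε, π⟩).card) =
        (4 * (X * Y)) ^ (peakSet π).card * (X + Y) ^ r := by
  classical
  -- `A i` records an ascent from `i` to `i + 1`. The fictitious ascent at `n` prevents `n` from
  -- being a peak.
  set A : ℕ → Prop := fun i => i = n ∨ value π i < value π (i + 1) with hA
  have hn : A n := Or.inl rfl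
  have h0 : A 0 := by
    rcases Nat.eq_zero_or_pos n with rfl | h
    · exact hn
    · refine Or.inr ?_
      rw [value_zero]
      exact value_pos π le_rfl h
  have hp : (peakSet π).card = ((Finset.range n).filter fun i => A i ∧ ¬ A (i + 1)).card := by
    symm
    refine Finset.card_bij (fun i _ => i + 1) ?_ (by simp) ?_
    · intro i hi
      simp only [Finset.mem_filter, Finset.mem_range, hA, peakSet, Finset.mem_Ico] at hi ⊢
      obtain ⟨h1, h2, h3⟩ := hi
      rw [not_or] at h3
      have := value_ne π (show i + 1 < n by omega)
      refine ⟨by omega, ?_, by omega⟩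
      rw [Nat.add_sub_cancel]
      omega
    · intro i hi
      simp only [Finset.mem_filter, peakSet, Finset.mem_Ico] at hi
      obtain ⟨h1, h2, h3⟩ := hi
      refine ⟨i - 1, ?_, by omega⟩
      have e : i - 1 + 1 = i := by omega
      simp only [Finset.mem_filter, Finset.mem_range, hA, e]
      refine ⟨by omega, Or.inr h2, ?_⟩
      rw [not_or]
      exact ⟨by omega, by omega⟩
  obtain ⟨r, hr⟩ := prod_stepFactor X Y A h0 n
  rw [if_pos hn, ← hp] at hr
  refine ⟨r, hr.1, ?_⟩
  rw [← hr.2, ← sum_prod_steps X Y n A hn]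
  refine Eq.trans ?_ (sum_signs_reindex π _)
  refine Finset.sum_congr rfl fun ε _ => ?_
  have := pow_card_filter_mul X Y (Finset.range n)
    (fun i => signedValue (⟨ε, π⟩ : SignedPerm n) i > signedValue (⟨ε, π⟩ : SignedPerm n) (i + 1))
  rw [Finset.card_range] at this
  unfold signedDes
  rw [this]
  refine Finset.prod_congr rfl fun i hi => ?_
  have hi := Finset.mem_range.1 hi
  simp only [signedValue_gt_iff _ hi]
  have hAi : A i ↔ value π i < value π (i + 1) := by simp [hA, hi.ne]
  by_cases h : value π i < value π (i + 1)
  · simp [hAi, h]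
  · have hi0 : i ≠ 0 := by
      rintro rfl
      exact h (hAi.1 h0)
    simp [hAi, h, hi0]

theorem sum_descents_sdiff_zero {R : Type*} [CommRing R] (X Y : R) {n : ℕ} (hn0 : 0 < n)
    (π : Equiv.Perm (Fin n)) :
    ∃ r, n = 2 * (peakSet π \ {1}).card + 1 + r ∧
      ∑ ε : Fin n → ℤˣ, X ^ (signedDes ⟨ε, π⟩ \ {0}).card *
          Y ^ (n - 1 - (signedDes ⟨ε, π⟩ \ {0}).card) =
        2 * (4 * (X * Y)) ^ (peakSet π \ {1}).card * (X + Y) ^ r := by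
  classical
  -- Declaring step 0 not to be an ascent gives it weight 1 and removes the possible peak at 1.
  set A : ℕ → Prop := fun i => i = n ∨ i ≠ 0 ∧ value π i < value π (i + 1) with hA
  have hn : A n := Or.inl rfl
  have h0 : ¬ A 0 := by
    simp [hA, hn0.ne]
  have hp : (peakSet π \ {1}).card =
      ((Finset.range n).filter fun i => A i ∧ ¬ A (i + 1)).card := by
    symm
    refine Finset.card_bij (fun i _ => i + 1) ?_ (by simp) ?_
    · intro i hi
      simp only [Finset.mem_filter, Finset.mem_range, hA, peakSet, Finset.mem_Ico,
        Finset.mem_sdiff, Finset.mem_singleton] at hi ⊢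
      obtain ⟨h1, h2, h3⟩ := hi
      rw [not_or, not_and] at h3
      have := value_ne π (show i + 1 < n by omega)
      have := h3.2 (by omega)
      refine ⟨⟨by omega, ?_, by omega⟩, by omega⟩
      rw [Nat.add_sub_cancel]
      omega
    · intro i hi
      simp only [Finset.mem_filter, peakSet, Finset.mem_Ico, Finset.mem_sdiff,
        Finset.mem_singleton] at hi
      obtain ⟨⟨h1, h2, h3⟩, h4⟩ := hi
      refine ⟨i - 1, ?_, by omega⟩
      have e : i - 1 + 1 = i := by omega
      simp only [Finset.mem_filter, Finset.mem_range, hA, e]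
      refine ⟨by omega, Or.inr ⟨by omega, h2⟩, ?_⟩
      rw [not_or]
      exact ⟨by omega, by omega⟩
  obtain ⟨r, hr⟩ := prod_stepFactor' X Y A h0 n
  rw [if_pos hn, ← hp] at hr
  refine ⟨r, hr.1, ?_⟩
  rw [← hr.2, ← sum_prod_steps X Y n A hn]
  refine Eq.trans ?_ (sum_signs_reindex π _)
  refine Finset.sum_congr rfl fun ε _ => ?_
  have := pow_card_filter_mul X Y (Finset.range n \ {0})
    (fun i => signedValue (⟨ε, π⟩ : SignedPerm n) i > signedValue (⟨ε, π⟩ : SignedPerm n) (i + 1))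
  have hc : (Finset.range n \ {0}).card = n - 1 := by
    rw [Finset.card_sdiff_of_subset (by simpa using hn0), Finset.card_range,
      Finset.card_singleton]
  have hf : signedDes (⟨ε, π⟩ : SignedPerm n) \ {0} = (Finset.range n \ {0}).filter
      (fun i => signedValue (⟨ε, π⟩ : SignedPerm n) i >
        signedValue (⟨ε, π⟩ : SignedPerm n) (i + 1)) := by
    ext i
    simp only [signedDes, Finset.mem_sdiff, Finset.mem_filter]
    tauto
  rw [hc] at this
  rw [hf, this]
  have hs : Finset.range n \ {0} = (Finset.range n).erase 0 := Finset.sdiff_singleton_eq_erase _ _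
  rw [hs, ← Finset.mul_prod_erase (Finset.range n) _ (Finset.mem_range.2 hn0)]
  rw [if_neg h0, if_pos rfl, one_mul]
  refine Finset.prod_congr rfl fun i hi => ?_
  obtain ⟨hi0, hi⟩ := Finset.mem_erase.1 hi
  have hi := Finset.mem_range.1 hi
  simp only [signedValue_gt_iff _ hi]
  have hAi : A i ↔ value π i < value π (i + 1) := by simp [hA, hi.ne, hi0]
  by_cases h : value π i < value π (i + 1) <;> simp [hAi, h, hi0]

theorem card_signedDes_le {n : ℕ} (σ : SignedPerm n) : (signedDes σ).card ≤ n :=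
  (Finset.card_filter_le (Finset.range n) _).trans_eq (Finset.card_range n)

theorem card_signedDes_sdiff_lt {n : ℕ} (hn : 0 < n) (σ : SignedPerm n) :
    (signedDes σ \ {0}).card < n := by
  have : signedDes σ \ {0} ⊆ Finset.Ico 1 n := by
    intro i
    simp only [signedDes, Finset.mem_sdiff, Finset.mem_filter, Finset.mem_range,
      Finset.mem_singleton, Finset.mem_Ico]
    omega
  have := Finset.card_le_card this
  rw [Nat.card_Ico] at this
  omega

/-! ### Integrated identities and the coefficients of the projections -/

theorem sum_trigIntegral_descents {n : ℕ} (π : Equiv.Perm (Fin n)) :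
    ∃ r, n = 2 * (peakSet π).card + r ∧
      ∑ ε : Fin n → ℤˣ, (-1) ^ (signedDes ⟨ε, π⟩).card *
        trigIntegral (2 * (signedDes ⟨ε, π⟩).card) (2 * (n - (signedDes ⟨ε, π⟩).card)) =
      (-1) ^ (peakSet π).card * ((1 + (-1) ^ r) / 2 * trigIntegral (2 * (peakSet π).card) r) := by
  -- Only the relation between `n`, the peaks and `r` is wanted, so the values of `X` and `Y` are
  -- immaterial.
  obtain ⟨r, hr, -⟩ := sum_descents (0 : ℝ) 0 π
  refine ⟨r, hr, ?_⟩
  rw [← integral_sin_pow_mul_cos_pow_double, ← intervalIntegral.integral_const_mul]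
  unfold trigIntegral
  simp only [← intervalIntegral.integral_const_mul]
  rw [← intervalIntegral.integral_finsetSum
    (fun _ _ => Continuous.intervalIntegrable (by fun_prop) _ _)]
  congr 1
  ext x
  obtain ⟨r', hr', h⟩ := sum_descents (-Real.sin x ^ 2) (Real.cos x ^ 2) π
  obtain rfl : r = r' := by omega
  rw [show -Real.sin x ^ 2 + Real.cos x ^ 2 = Real.cos (2 * x) by
    rw [Real.cos_two_mul']; ring,
    show 4 * (-Real.sin x ^ 2 * Real.cos x ^ 2) = -1 * Real.sin (2 * x) ^ 2 by
    rw [Real.sin_two_mul]; ring, mul_pow, ← pow_mul, mul_assoc] at h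
  rw [← h]
  refine Finset.sum_congr rfl fun ε _ => ?_
  rw [neg_eq_neg_one_mul (Real.sin x ^ 2), mul_pow, ← pow_mul, ← pow_mul, mul_assoc]

theorem sum_trigIntegral_descents_sdiff_zero {n : ℕ} (hn : 0 < n) (π : Equiv.Perm (Fin n)) :
    ∃ r, n = 2 * (peakSet π \ {1}).card + 1 + r ∧
      ∑ ε : Fin n → ℤˣ, (-1) ^ (signedDes ⟨ε, π⟩ \ {0}).card *
        trigIntegral (2 * (signedDes ⟨ε, π⟩ \ {0}).card + 1)
          (2 * (n - 1 - (signedDes ⟨ε, π⟩ \ {0}).card) + 1) =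
      (-1) ^ (peakSet π \ {1}).card *
        ((1 + (-1) ^ r) / 2 * trigIntegral (2 * (peakSet π \ {1}).card + 1) r) := by
  obtain ⟨r, hr, -⟩ := sum_descents_sdiff_zero (0 : ℝ) 0 hn π
  refine ⟨r, hr, ?_⟩
  rw [← integral_sin_pow_mul_cos_pow_double, ← intervalIntegral.integral_const_mul]
  unfold trigIntegral
  simp only [← intervalIntegral.integral_const_mul]
  rw [← intervalIntegral.integral_finsetSum
    (fun _ _ => Continuous.intervalIntegrable (by fun_prop) _ _)]
  congr 1
  ext x
  obtain ⟨r', hr', h⟩ := sum_descents_sdiff_zero (-Real.sin x ^ 2) (Real.cos x ^ 2) hn π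
  obtain rfl : r = r' := by omega
  rw [show -Real.sin x ^ 2 + Real.cos x ^ 2 = Real.cos (2 * x) by
    rw [Real.cos_two_mul']; ring,
    show 4 * (-Real.sin x ^ 2 * Real.cos x ^ 2) = -1 * Real.sin (2 * x) ^ 2 by
    rw [Real.sin_two_mul]; ring, mul_pow, ← pow_mul] at h
  rw [pow_succ (Real.sin (2 * x))]
  have e := Real.sin_two_mul x
  -- The odd exponents leave one factor `sin x cos x = sin 2x / 2`, which absorbs the factor 2 of
  -- `sum_descents_sdiff_zero`.
  calc _ = (Real.sin x * Real.cos x) * ∑ ε : Fin n → ℤˣ,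
        (-Real.sin x ^ 2) ^ (signedDes ⟨ε, π⟩ \ {0}).card *
          (Real.cos x ^ 2) ^ (n - 1 - (signedDes ⟨ε, π⟩ \ {0}).card) := by
        rw [Finset.mul_sum]
        refine Finset.sum_congr rfl fun ε _ => ?_
        rw [neg_eq_neg_one_mul (Real.sin x ^ 2), mul_pow, ← pow_mul, ← pow_mul]
        ring
    _ = _ := by
        rw [h]
        linear_combination (-(-1) ^ (peakSet π \ {1}).card *
          Real.sin (2 * x) ^ (2 * (peakSet π \ {1}).card) * Real.cos (2 * x) ^ r) * e

/-- Denominators are cleared and the identity is stated in `ℤ`, so that it can be cast into any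
field; the proof passes through real integrals. -/
theorem sum_doubleFactorial_descents {n : ℕ} (π : Equiv.Perm (Fin n)) :
    (n‼ : ℤ) * ∑ ε : Fin n → ℤˣ, (-1 : ℤ) ^ (signedDes ⟨ε, π⟩).card *
        ((2 * (signedDes ⟨ε, π⟩).card - 1)‼ : ℕ) *
        ((2 * n - 2 * (signedDes ⟨ε, π⟩).card - 1)‼ : ℕ) =
      ((2 * n)‼ : ℕ) * if Even n then (-1 : ℤ) ^ (peakSet π).card *
        ((2 * (peakSet π).card - 1)‼ : ℕ) * ((n - 2 * (peakSet π).card - 1)‼ : ℕ) else 0 := by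
  obtain ⟨r, hr, h⟩ := sum_trigIntegral_descents π
  have e1 : ∀ ε : Fin n → ℤˣ, (-1 : ℝ) ^ (signedDes ⟨ε, π⟩).card *
        ((2 * (signedDes ⟨ε, π⟩).card - 1)‼ : ℕ) *
        ((2 * n - 2 * (signedDes ⟨ε, π⟩).card - 1)‼ : ℕ) = (2 / Real.pi) * ((2 * n)‼ : ℕ) *
      ((-1 : ℝ) ^ (signedDes ⟨ε, π⟩).card *
        trigIntegral (2 * (signedDes ⟨ε, π⟩).card) (2 * (n - (signedDes ⟨ε, π⟩).card))) := by
    intro ε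
    have hd := card_signedDes_le (⟨ε, π⟩ : SignedPerm n)
    have := trigIntegral_eq (2 * (signedDes ⟨ε, π⟩).card) (2 * (n - (signedDes ⟨ε, π⟩).card))
    rw [if_pos ⟨by simp, by simp⟩, ← mul_add, Nat.add_sub_cancel' hd, Nat.mul_sub] at this
    rw [Nat.mul_sub]
    have hpi := Real.pi_ne_zero
    have e2 : ∀ a b c x f : ℝ, x * f = Real.pi / 2 * b * c →
        a * b * c = 2 / Real.pi * f * (a * x) := by
      intro a b c x f hh
      field_simp
      linear_combination (-2 * a) * hh
    exact e2 _ _ _ _ _ this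
  have e3 := trigIntegral_eq (2 * (peakSet π).card) r
  rw [← hr] at e3
  have hpi := Real.pi_ne_zero
  have : ((n‼ : ℕ) : ℝ) * ∑ ε : Fin n → ℤˣ, (-1 : ℝ) ^ (signedDes ⟨ε, π⟩).card *
        ((2 * (signedDes ⟨ε, π⟩).card - 1)‼ : ℕ) *
        ((2 * n - 2 * (signedDes ⟨ε, π⟩).card - 1)‼ : ℕ) =
      ((2 * n)‼ : ℕ) * if Even n then (-1 : ℝ) ^ (peakSet π).card *
        ((2 * (peakSet π).card - 1)‼ : ℕ) * ((n - 2 * (peakSet π).card - 1)‼ : ℕ) else 0 := by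
    rw [Finset.sum_congr rfl fun ε _ => e1 ε, ← Finset.mul_sum, h,
      show n - 2 * (peakSet π).card - 1 = r - 1 by omega]
    have hpar : Even n ↔ Even r := by
      rw [hr, Nat.even_add]
      simp
    by_cases hev : Even n
    · rw [if_pos ⟨by simp, hpar.1 hev⟩] at e3
      rw [if_pos hev, (hpar.1 hev).neg_one_pow]
      field_simp
      linear_combination 2 * e3
    · rw [if_neg hev, (Nat.not_even_iff_odd.1 (hpar.not.1 hev)).neg_one_pow]
      simp
  have h' : ((((n‼ : ℕ) : ℤ) * ∑ ε : Fin n → ℤˣ, (-1 : ℤ) ^ (signedDes ⟨ε, π⟩).card *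
        ((2 * (signedDes ⟨ε, π⟩).card - 1)‼ : ℕ) *
        ((2 * n - 2 * (signedDes ⟨ε, π⟩).card - 1)‼ : ℕ) : ℤ) : ℝ) =
      ((((2 * n)‼ : ℕ) * if Even n then (-1 : ℤ) ^ (peakSet π).card *
        ((2 * (peakSet π).card - 1)‼ : ℕ) * ((n - 2 * (peakSet π).card - 1)‼ : ℕ) else 0 : ℤ) : ℝ) := by
    push_cast
    exact this
  exact_mod_cast h'

theorem sum_factorial_descents {n : ℕ} (hn : 0 < n) (π : Equiv.Perm (Fin n)) :
    (n‼ : ℤ) * ∑ ε : Fin n → ℤˣ, (-1 : ℤ) ^ (signedDes ⟨ε, π⟩ \ {0}).card *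
        ((signedDes ⟨ε, π⟩ \ {0}).card ! : ℕ) *
        ((n - 1 - (signedDes ⟨ε, π⟩ \ {0}).card)! : ℕ) =
      (n ! : ℕ) * if Even n then 0 else 2 * ((-1 : ℤ) ^ (peakSet π \ {1}).card *
        ((2 * (peakSet π \ {1}).card)‼ : ℕ) * ((n - 2 * (peakSet π \ {1}).card - 2)‼ : ℕ)) := by
  obtain ⟨r, hr, h⟩ := sum_trigIntegral_descents_sdiff_zero hn π
  have e1 : ∀ ε : Fin n → ℤˣ, (-1 : ℝ) ^ (signedDes ⟨ε, π⟩ \ {0}).card *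
        ((signedDes ⟨ε, π⟩ \ {0}).card ! : ℕ) *
        ((n - 1 - (signedDes ⟨ε, π⟩ \ {0}).card)! : ℕ) = 2 * (n ! : ℕ) *
      ((-1 : ℝ) ^ (signedDes ⟨ε, π⟩ \ {0}).card *
        trigIntegral (2 * (signedDes ⟨ε, π⟩ \ {0}).card + 1)
          (2 * (n - 1 - (signedDes ⟨ε, π⟩ \ {0}).card) + 1)) := by
    intro ε
    have hd := card_signedDes_sdiff_lt hn (⟨ε, π⟩ : SignedPerm n)
    generalize (signedDes (⟨ε, π⟩ : SignedPerm n) \ {0}).card = d at hd ⊢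
    obtain ⟨c, rfl⟩ : ∃ c, n = d + c + 1 := ⟨n - 1 - d, by omega⟩
    have := trigIntegral_eq (2 * d + 1) (2 * c + 1)
    rw [if_neg (by simp), show 2 * d + 1 + (2 * c + 1) = 2 * (d + c + 1) by ring,
      Nat.add_sub_cancel, Nat.add_sub_cancel, Nat.doubleFactorial_two_mul,
      Nat.doubleFactorial_two_mul, Nat.doubleFactorial_two_mul] at this
    push_cast at this
    rw [show d + c + 1 - 1 - d = c by omega]
    have h2 : (2 : ℝ) ^ (d + c) ≠ 0 := by positivity
    apply mul_left_cancel₀ h2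
    rw [pow_add] at *
    linear_combination (-(-1) ^ d) * this
  have e3 := trigIntegral_eq (2 * (peakSet π \ {1}).card + 1) r
  rw [add_assoc, add_comm 1 r, ← add_assoc, add_right_comm, ← hr, if_neg (by simp),
    Nat.add_sub_cancel] at e3
  have : ((n‼ : ℕ) : ℝ) * ∑ ε : Fin n → ℤˣ, (-1 : ℝ) ^ (signedDes ⟨ε, π⟩ \ {0}).card *
        ((signedDes ⟨ε, π⟩ \ {0}).card ! : ℕ) *
        ((n - 1 - (signedDes ⟨ε, π⟩ \ {0}).card)! : ℕ) =
      (n ! : ℕ) * if Even n then 0 else 2 * ((-1 : ℝ) ^ (peakSet π \ {1}).card *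
        ((2 * (peakSet π \ {1}).card)‼ : ℕ) * ((n - 2 * (peakSet π \ {1}).card - 2)‼ : ℕ)) := by
    rw [Finset.sum_congr rfl fun ε _ => e1 ε, ← Finset.mul_sum, h,
      show n - 2 * (peakSet π \ {1}).card - 2 = r - 1 by omega]
    have hpar : Even n ↔ ¬ Even r := by
      rw [hr, Nat.even_add, Nat.even_add]
      simp
    by_cases hev : Even n
    · rw [if_pos hev, (Nat.not_even_iff_odd.1 (hpar.1 hev)).neg_one_pow]
      simp
    · have hev' : Even r := by tauto
      rw [if_neg hev, hev'.neg_one_pow]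
      linear_combination (2 * (n ! : ℝ) * (-1) ^ (peakSet π \ {1}).card) * e3
  have h' : ((((n‼ : ℕ) : ℤ) * ∑ ε : Fin n → ℤˣ, (-1 : ℤ) ^ (signedDes ⟨ε, π⟩ \ {0}).card *
        ((signedDes ⟨ε, π⟩ \ {0}).card ! : ℕ) *
        ((n - 1 - (signedDes ⟨ε, π⟩ \ {0}).card)! : ℕ) : ℤ) : ℝ) =
      (((n ! : ℕ) * if Even n then 0 else 2 * ((-1 : ℤ) ^ (peakSet π \ {1}).card *
        ((2 * (peakSet π \ {1}).card)‼ : ℕ) *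
        ((n - 2 * (peakSet π \ {1}).card - 2)‼ : ℕ)) : ℤ) : ℝ) := by
    push_cast
    exact this
  exact_mod_cast h'

/-! ### Chambers of the signed permutation group and standardization -/

/-- A vector with `0 < F 0 < F 1 < ⋯`. -/
def Chamber {n : ℕ} (F : Fin n → ℤ) : Prop := StrictMono F ∧ ∀ i, 0 < F i

/-- Composition of an odd function with a signed permutation. -/
def act {n : ℕ} (σ : SignedPerm n) (F : Fin n → ℤ) : Fin n → ℤ :=
  fun i => (σ.left (σ.right i) : ℤ) * F (σ.right i)

/-- Precomposition is a right action, hence the reversed order. -/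
theorem act_mul {n : ℕ} (σ τ : SignedPerm n) (F : Fin n → ℤ) :
    act (σ * τ) F = act τ (act σ F) := by
  funext i
  have h : ((mulAutArrow σ.right : MulAut (Fin n → ℤˣ)) τ.left) (σ.right (τ.right i)) =
      τ.left (τ.right i) := by
    change τ.left (σ.right⁻¹ • (σ.right (τ.right i))) = _
    simp
  simp only [act, SemidirectProduct.mul_left, SemidirectProduct.mul_right, Pi.mul_apply,
    Equiv.Perm.mul_apply, h, Units.val_mul]
  ring

theorem act_one {n : ℕ} (F : Fin n → ℤ) : act 1 F = F := by
  funext i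
  simp [act]

theorem act_inv_act {n : ℕ} (σ : SignedPerm n) (F : Fin n → ℤ) : act σ⁻¹ (act σ F) = F := by
  rw [← act_mul, mul_inv_cancel, act_one]

theorem act_act_inv {n : ℕ} (σ : SignedPerm n) (F : Fin n → ℤ) : act σ (act σ⁻¹ F) = F := by
  rw [← act_mul, inv_mul_cancel, act_one]

theorem act_linear {n : ℕ} (σ : SignedPerm n) (a : ℤ) (F G : Fin n → ℤ) :
    act σ (fun i => a * F i + G i) = fun i => a * act σ F i + act σ G i := by
  funext i
  simp only [act]
  ring

theorem abs_act {n : ℕ} (σ : SignedPerm n) (F : Fin n → ℤ) (i : Fin n) :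
    |act σ F i| = |F (σ.right i)| := by
  rcases Int.units_eq_one_or (σ.left (σ.right i)) with h | h <;> simp [act, h]

theorem exists_chamber {n : ℕ} (F : Fin n → ℤ) (h0 : ∀ i, F i ≠ 0)
    (hF : Function.Injective fun i => |F i|) : ∃ σ : SignedPerm n, Chamber (act σ F) := by
  let π := Tuple.sort fun i => |F i|
  let ε : Fin n → ℤˣ := fun i => if 0 < F i then 1 else -1
  have e : act (⟨ε, π⟩ : SignedPerm n) F = fun i => |F (π i)| := by
    funext i
    simp only [act, ε]
    rcases lt_or_gt_of_ne (h0 (π i)) with h | h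
    · rw [if_neg h.not_gt, abs_of_neg h]; simp
    · rw [if_pos h, abs_of_pos h]; simp
  refine ⟨⟨ε, π⟩, ?_, ?_⟩
  · rw [e]
    exact (Tuple.monotone_sort fun i => |F i|).strictMono_of_injective (hF.comp π.injective)
  · intro i
    rw [e]
    exact abs_pos.2 (h0 _)

/-- In the chamber all entries are positive, so the result is the vector of absolute values in
increasing order: this forces the permutation, and positivity then forces the signs. -/
theorem chamber_unique {n : ℕ} {F : Fin n → ℤ} {σ τ : SignedPerm n} (hσ : Chamber (act σ F))
    (hτ : Chamber (act τ F)) : σ = τ := by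
  have hs : ∀ ρ : SignedPerm n, Chamber (act ρ F) →
      act ρ F = (fun i => |F i|) ∘ ρ.right ∧ StrictMono ((fun i => |F i|) ∘ ρ.right) := by
    intro ρ h
    have e : act ρ F = (fun i => |F i|) ∘ ρ.right := by
      funext i
      rw [Function.comp_apply, ← abs_act ρ F i, abs_of_pos (h.2 i)]
    exact ⟨e, e ▸ h.1⟩
  have h1 := hs σ hσ
  have h2 := hs τ hτ
  have hinj : Function.Injective (fun i => |F i|) := by
    have := h1.2.injective
    intro i j hij
    have h3 : ((fun i => |F i|) ∘ σ.right) (σ.right.symm i) =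
      ((fun i => |F i|) ∘ σ.right) (σ.right.symm j) := by simpa using hij
    exact σ.right.symm.injective (this h3)
  have hr : σ.right = τ.right := by
    have h3 : (fun i => |F i|) ∘ σ.right = (fun i => |F i|) ∘ τ.right := by
      rw [← StrictMono.range_inj h1.2 h2.2, Set.range_comp, Set.range_comp,
        σ.right.surjective.range_eq, τ.right.surjective.range_eq]
    ext i
    exact congrArg Fin.val (hinj (congrFun h3 i))
  have hl : σ.left = τ.left := by
    funext j
    have hp : ∀ ρ : SignedPerm n, Chamber (act ρ F) → 0 < (ρ.left j : ℤ) * F j := by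
      intro ρ h
      have := h.2 (ρ.right.symm j)
      simpa [act] using this
    have a := hp σ hσ
    have b := hp τ hτ
    rcases Int.units_eq_one_or (σ.left j) with h | h <;>
    rcases Int.units_eq_one_or (τ.left j) with h' | h' <;>
    rw [h] at a ⊢ <;> rw [h'] at b ⊢ <;> simp at a b <;> omega
  exact SemidirectProduct.ext hl hr

/-- The vector `(1, 2, …, n)`. -/
def idVec (n : ℕ) : Fin n → ℤ := fun i => (i : ℤ) + 1

/-- An integer encoding of the lexicographic order on pairs `(f i, i)`. -/
def key {n : ℕ} (f : Fin n → ℤ) : Fin n → ℤ := fun i => (2 * n + 2) * f i + idVec n i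

theorem abs_act_idVec_le {n : ℕ} (σ : SignedPerm n) (i : Fin n) : |act σ (idVec n) i| ≤ n := by
  rw [abs_act, idVec, abs_of_pos (by positivity)]
  have := (σ.right i).2
  omega

theorem exists_chamber_key {n : ℕ} (f : Fin n → ℤ) :
    ∃ σ : SignedPerm n, Chamber (act σ (key f)) := by
  apply exists_chamber
  · intro i h
    -- Modulo `2n + 2` the key is `i + 1`, lying between 1 and `n`. A zero entry, or two equal
    -- absolute values, would make `i + 1`, `i - j` or `i + j + 2` divisible by `2n + 2`, too large
    -- a modulus unless `i = j`.
    have h1 : (2 * n + 2 : ℤ) ∣ idVec n i := ⟨-f i, by unfold key at h; linear_combination h⟩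
    have h2 := Int.eq_zero_of_abs_lt_dvd h1 (by
      rw [idVec, abs_of_pos (by positivity)]
      have := i.2
      omega)
    unfold idVec at h2
    omega
  · intro i j h
    have hi := i.2
    have hj := j.2
    rcases abs_eq_abs.1 h with h | h
    · have h1 : (2 * n + 2 : ℤ) ∣ (i : ℤ) - j :=
        ⟨f j - f i, by unfold key idVec at h; linear_combination h⟩
      have h2 := Int.eq_zero_of_abs_lt_dvd h1 (by rw [abs_lt]; omega)
      exact Fin.ext (by omega)
    · have h1 : (2 * n + 2 : ℤ) ∣ (i : ℤ) + j + 2 :=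
        ⟨-f j - f i, by unfold key idVec at h; linear_combination h⟩
      have h2 := Int.eq_zero_of_abs_lt_dvd h1 (by rw [abs_lt]; omega)
      omega

/-- The standardization of a word in the integers. -/
noncomputable def std {n : ℕ} (f : Fin n → ℤ) : SignedPerm n := (exists_chamber_key f).choose

theorem chamber_std {n : ℕ} (f : Fin n → ℤ) : Chamber (act (std f) (key f)) :=
  (exists_chamber_key f).choose_spec

theorem std_eq_iff {n : ℕ} (f : Fin n → ℤ) (σ : SignedPerm n) :
    std f = σ ↔ Chamber (act σ (key f)) :=
  ⟨fun h => h ▸ chamber_std f, fun h => chamber_unique (chamber_std f) h⟩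

/-! ### Words over a symmetric alphabet and their product rule -/

/-- The alphabet `{-(m-1), -(m-3), …, m-1}`. -/
def letters (m : ℕ) : Finset ℤ := (Finset.range m).image fun a : ℕ => 2 * (a : ℤ) - m + 1

theorem mem_letters {m : ℕ} {v : ℤ} :
    v ∈ letters m ↔ ∃ a : ℤ, 0 ≤ a ∧ a < m ∧ v = 2 * a - m + 1 := by
  simp only [letters, Finset.mem_image, Finset.mem_range]
  constructor
  · rintro ⟨a, h, rfl⟩
    exact ⟨a, by omega, by omega, rfl⟩
  · rintro ⟨a, h, h', rfl⟩
    exact ⟨a.toNat, by omega, by omega⟩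

theorem card_letters (m : ℕ) : (letters m).card = m := by
  rw [letters, Finset.card_image_of_injective _ (fun a b h => by
    omega), Finset.card_range]

/-- Words of length `n` in `letters m`. -/
def words (n m : ℕ) : Finset (Fin n → ℤ) := Fintype.piFinset fun _ => letters m

theorem mem_words {n m : ℕ} {f : Fin n → ℤ} : f ∈ words n m ↔ ∀ i, f i ∈ letters m :=
  Fintype.mem_piFinset

theorem card_words (n m : ℕ) : (words n m).card = m ^ n := by
  simp [words, card_letters]

theorem act_mem_words {n m : ℕ} {f : Fin n → ℤ} (σ : SignedPerm n) (hf : f ∈ words n m) :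
    act σ f ∈ words n m := by
  rw [mem_words] at *
  intro i
  obtain ⟨a, h1, h2, h3⟩ := mem_letters.1 (hf (σ.right i))
  rw [mem_letters, act, h3]
  rcases Int.units_eq_one_or (σ.left (σ.right i)) with h | h
  · exact ⟨a, h1, h2, by rw [h]; simp⟩
  · exact ⟨m - 1 - a, by omega, by omega, by rw [h]; push_cast; ring⟩

/-- All vectors in the chamber are ordered alike by `τ`; comparing with the model `idVec n`
suffices. -/
theorem Chamber.act_lt {n : ℕ} {u : Fin n → ℤ} (hu : Chamber u) (τ : SignedPerm n) {i j : Fin n}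
    (h : act τ (idVec n) i < act τ (idVec n) j) : act τ u i < act τ u j := by
  unfold act idVec at *
  have hi := hu.2 (τ.right i)
  have hj := hu.2 (τ.right j)
  rcases Int.units_eq_one_or (τ.left (τ.right i)) with h1 | h1 <;>
  rcases Int.units_eq_one_or (τ.left (τ.right j)) with h2 | h2 <;>
  rw [h1, h2] at h ⊢ <;> simp only [Units.val_one, Units.val_neg, one_mul, neg_mul] at h ⊢
  · exact hu.1 (Fin.lt_def.2 (by omega))
  · omega
  · omega
  · exact neg_lt_neg (hu.1 (Fin.lt_def.2 (by omega)))

theorem Chamber.act_pos {n : ℕ} {u : Fin n → ℤ} (hu : Chamber u) (τ : SignedPerm n) {i : Fin n}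
    (h : 0 < act τ (idVec n) i) : 0 < act τ u i := by
  unfold act idVec at *
  have hi := hu.2 (τ.right i)
  rcases Int.units_eq_one_or (τ.left (τ.right i)) with h1 | h1 <;>
  rw [h1] at h ⊢ <;> simp only [Units.val_one, Units.val_neg, one_mul, neg_mul] at h ⊢ <;> omega

/-- The word encoding the pairs of letters of `g` (read along `std f`) and `f`. -/
noncomputable def interlace {n : ℕ} (p : ℕ) (f g : Fin n → ℤ) : Fin n → ℤ :=
  fun i => p * act (std f)⁻¹ g i + f i

theorem abs_key_le {n m : ℕ} {f : Fin n → ℤ} (hf : f ∈ words n m) (i : Fin n) :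
    |key f i| ≤ (2 * n + 2) * ((m : ℤ) - 1) + n := by
  obtain ⟨a, h1, h2, h3⟩ := mem_letters.1 (mem_words.1 hf i)
  have hi := i.2
  have h4 : |f i| ≤ (m : ℤ) - 1 := by rw [h3, abs_le]; omega
  have h5 : |idVec n i| ≤ n := by
    rw [idVec, abs_of_pos (by positivity)]
    omega
  unfold key
  refine (abs_add_le _ _).trans (add_le_add ?_ h5)
  rw [abs_mul, abs_of_pos (by positivity)]
  exact mul_le_mul_of_nonneg_left h4 (by positivity)

/-- After acting by `std f`, the key is `(2n+2)p` times `g` plus a chamber vector `u`. Letters of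
`g` have the same parity, so distinct ones differ by at least 2, which outweighs any difference of
entries of `u`; a positive letter likewise outweighs one entry. Ties and zeros are resolved by `u`
exactly as by `idVec n`, so `std g` finishes the sorting. -/
theorem std_interlace {n p q : ℕ} {f g : Fin n → ℤ} (hf : f ∈ words n p) (hg : g ∈ words n q) :
    std (interlace p f g) = std f * std g := by
  rw [std_eq_iff]
  set τ := std g
  set u := act (std f) (key f) with hu
  have hk : key (interlace p f g) =
      fun i => ((2 * n + 2) * p) * act (std f)⁻¹ g i + key f i := by
    funext i
    simp only [key, interlace]
    ring
  rw [act_mul, hk, act_linear, act_act_inv, act_linear]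
  have hu' : Chamber u := chamber_std f
  have hg' := chamber_std g
  have hg'' : act τ (key g) = fun i => (2 * n + 2) * act τ g i + act τ (idVec n) i :=
    act_linear τ _ _ _
  rw [hg''] at hg'
  have hU : ∀ i, |act τ u i| ≤ (2 * n + 2) * ((p : ℤ) - 1) + n := by
    intro i
    rw [abs_act, hu, abs_act]
    exact abs_key_le hf _
  have hW := abs_act_idVec_le τ
  have hG := mem_words.1 (act_mem_words τ hg)
  constructor
  · intro i j hij
    have h1 := hg'.1 hij
    simp only at h1 ⊢
    have hWi := abs_le.1 (hW i)
    have hWj := abs_le.1 (hW j)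
    have hUi := abs_le.1 (hU i)
    have hUj := abs_le.1 (hU j)
    obtain ⟨a, -, -, ha⟩ := mem_letters.1 (hG i)
    obtain ⟨b, -, -, hb⟩ := mem_letters.1 (hG j)
    rcases lt_trichotomy (act τ g i) (act τ g j) with h | h | h
    · have h2 : act τ g i + 2 ≤ act τ g j := by omega
      have h3 := mul_le_mul_of_nonneg_left h2 (show (0 : ℤ) ≤ (2 * n + 2) * p by positivity)
      linarith
    · rw [h] at h1 ⊢
      have := hu'.act_lt τ (i := i) (j := j) (by linarith)
      linarith
    · have h3 := mul_le_mul_of_nonneg_left (show act τ g j + 1 ≤ act τ g i from h)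
        (show (0 : ℤ) ≤ 2 * n + 2 by positivity)
      linarith
  · intro i
    have h1 := hg'.2 i
    simp only at h1 ⊢
    have hWi := abs_le.1 (hW i)
    have hUi := abs_le.1 (hU i)
    rcases lt_trichotomy (act τ g i) 0 with h | h | h
    · have h3 := mul_le_mul_of_nonneg_left (show act τ g i + 1 ≤ 0 from h)
        (show (0 : ℤ) ≤ 2 * n + 2 by positivity)
      linarith
    · rw [h] at h1 ⊢
      have := hu'.act_pos τ (i := i) (by linarith)
      linarith
    · have h3 := mul_le_mul_of_nonneg_left (show 1 ≤ act τ g i from h)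
        (show (0 : ℤ) ≤ (2 * n + 2) * p by positivity)
      linarith

/-- With letters indexed from 0, the index of the combined letter is `p * b + a`: base `p` digits.
-/
theorem interlace_mem_words {n p q : ℕ} {f g : Fin n → ℤ} (hf : f ∈ words n p)
    (hg : g ∈ words n q) : interlace p f g ∈ words n (p * q) := by
  rw [mem_words]
  intro i
  obtain ⟨a, ha, ha', h1⟩ := mem_letters.1 (mem_words.1 hf i)
  obtain ⟨b, hb, hb', h2⟩ := mem_letters.1 (mem_words.1 (act_mem_words (std f)⁻¹ hg) i)
  rw [mem_letters, interlace, h1, h2]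
  refine ⟨p * b + a, by positivity, ?_, by push_cast; ring⟩
  have := mul_le_mul_of_nonneg_left (show b + 1 ≤ q from hb') (show (0 : ℤ) ≤ p by positivity)
  push_cast
  linarith

theorem interlace_injOn {n p q : ℕ} : Set.InjOn (fun x : (Fin n → ℤ) × (Fin n → ℤ) =>
    interlace p x.1 x.2) (words n p ×ˢ words n q : Finset _) := by
  rintro ⟨f, g⟩ h ⟨f', g'⟩ h' e
  simp only [Finset.coe_product, Set.mem_prod, Finset.mem_coe] at h h' e
  have hff : f = f' := by
    funext i
    have ei := congrFun e i
    obtain ⟨a, ha, ha', h1⟩ := mem_letters.1 (mem_words.1 h.1 i)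
    obtain ⟨b, hb, hb', h2⟩ := mem_letters.1 (mem_words.1 (act_mem_words (std f)⁻¹ h.2) i)
    obtain ⟨c, hc, hc', h3⟩ := mem_letters.1 (mem_words.1 h'.1 i)
    obtain ⟨d, hd, hd', h4⟩ := mem_letters.1 (mem_words.1 (act_mem_words (std f')⁻¹ h'.2) i)
    unfold interlace at ei
    rw [h1, h2, h3, h4] at ei
    have hdv : (p : ℤ) ∣ a - c := ⟨d - b, by linarith⟩
    have := Int.eq_zero_of_abs_lt_dvd hdv (by rw [abs_lt]; omega)
    rw [h1, h3]
    omega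
  subst hff
  have hgg : act (std f)⁻¹ g = act (std f)⁻¹ g' := by
    funext i
    have ei := congrFun e i
    obtain ⟨a, ha, ha', h1⟩ := mem_letters.1 (mem_words.1 h.1 i)
    unfold interlace at ei
    exact mul_left_cancel₀ (show (p : ℤ) ≠ 0 by omega) (add_right_cancel ei)
  have := congrArg (act (std f)) hgg
  rw [act_act_inv, act_act_inv] at this
  rw [this]

/-- The sum of the standardizations of all words in `letters m`. -/
noncomputable def wordSum (n m : ℕ) : MonoidAlgebra ℚ (SignedPerm n) :=
  ∑ f ∈ words n m, MonoidAlgebra.of ℚ (SignedPerm n) (std f)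

/-- Interlacing is injective and both sides have `(pq)^n` elements, so it is a bijection, and it
multiplies standardizations. -/
theorem wordSum_mul (n p q : ℕ) : wordSum n p * wordSum n q = wordSum n (p * q) := by
  classical
  have himg : (words n p ×ˢ words n q).image (fun x => interlace p x.1 x.2) =
      words n (p * q) := by
    apply Finset.eq_of_subset_of_card_le
    · intro h hh
      obtain ⟨x, hx, rfl⟩ := Finset.mem_image.1 hh
      rw [Finset.mem_product] at hx
      exact interlace_mem_words hx.1 hx.2
    · rw [Finset.card_image_of_injOn interlace_injOn, Finset.card_product, card_words,
        card_words, card_words, mul_pow]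
  unfold wordSum
  rw [← himg, Finset.sum_image interlace_injOn, Finset.sum_mul_sum, ← Finset.sum_product']
  refine Finset.sum_congr rfl fun x hx => ?_
  rw [Finset.mem_product] at hx
  rw [std_interlace hx.1 hx.2, map_mul]

/-! ### Counting words with a given standardization -/

theorem card_bounded_chamber (n K : ℕ) :
    ((Fintype.piFinset fun _ : Fin n => Finset.Icc (1 : ℤ) K).filter fun c => StrictMono c).card =
      K.choose n := by
  classical
  have : (Finset.powersetCard n (Finset.Icc (1 : ℤ) K)).card = K.choose n := by
    rw [Finset.card_powersetCard, Int.card_Icc]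
    congr 1
    omega
  rw [← this]
  refine Finset.card_bij (fun c _ => Finset.univ.image c) ?_ ?_ ?_
  · intro c hc
    rw [Finset.mem_filter, Fintype.mem_piFinset] at hc
    rw [Finset.mem_powersetCard]
    refine ⟨?_, ?_⟩
    · intro v hv
      obtain ⟨i, -, rfl⟩ := Finset.mem_image.1 hv
      exact hc.1 i
    · rw [Finset.card_image_of_injective _ hc.2.injective, Finset.card_univ, Fintype.card_fin]
  · intro c hc d hd h
    rw [Finset.mem_filter] at hc hd
    rw [← StrictMono.range_inj hc.2 hd.2]
    have := congrArg (fun s : Finset ℤ => (s : Set ℤ)) h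
    simpa using this
  · intro s hs
    rw [Finset.mem_powersetCard] at hs
    refine ⟨s.orderEmbOfFin hs.2, ?_, ?_⟩
    · rw [Finset.mem_filter, Fintype.mem_piFinset]
      exact ⟨fun i => hs.1 (Finset.orderEmbOfFin_mem s hs.2 i),
        (s.orderEmbOfFin hs.2).strictMono⟩
    · apply Finset.coe_injective
      simp

/-- The entries of a vector in the one-based convention, extended by `0`. -/
def oneBased {n : ℕ} (F : Fin n → ℤ) (i : ℕ) : ℤ :=
  if h : 1 ≤ i ∧ i ≤ n then F ⟨i - 1, by omega⟩ else 0

theorem oneBased_zero {n : ℕ} (F : Fin n → ℤ) : oneBased F 0 = 0 := by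
  simp [oneBased]

theorem oneBased_succ {n : ℕ} (F : Fin n → ℤ) {i : ℕ} (h : i < n) :
    oneBased F (i + 1) = F ⟨i, h⟩ := by
  unfold oneBased
  rw [dif_pos ⟨by omega, h⟩]
  rfl

theorem signedValue_eq_oneBased {n : ℕ} (σ : SignedPerm n) (i : ℕ) :
    signedValue σ i = oneBased (act σ (idVec n)) i := rfl

theorem le_of_forall_step {n : ℕ} {β : ℕ → ℤ} (h : ∀ i < n, β i ≤ β (i + 1)) {i j : ℕ}
    (hij : i ≤ j) (hj : j ≤ n) : β i ≤ β j := by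
  induction j, hij using Nat.le_induction with
  | base => exact le_rfl
  | succ j hij ih => exact (ih (by omega)).trans (h j (by omega))

theorem chamber_iff_step {n : ℕ} (F : Fin n → ℤ) :
    Chamber F ↔ ∀ i < n, oneBased F i < oneBased F (i + 1) := by
  constructor
  · rintro ⟨h1, h2⟩ i hi
    rw [oneBased_succ F hi]
    cases i with
    | zero => rw [oneBased_zero]; exact h2 _
    | succ i =>
      rw [oneBased_succ F (by omega)]
      exact h1 (Fin.lt_def.2 (Nat.lt_succ_self i))
  · intro h
    have hlt : ∀ i j, i < j → j ≤ n → oneBased F i < oneBased F j := fun i j hij hj =>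
      (h i (by omega)).trans_le (le_of_forall_step (fun i hi => (h i hi).le) hij hj)
    constructor
    · intro i j hij
      have := hlt (i + 1) (j + 1) (by simpa using hij) j.2
      rwa [oneBased_succ F i.2, oneBased_succ F j.2] at this
    · intro i
      have := hlt 0 (i + 1) (by omega) i.2
      rwa [oneBased_succ F i.2, oneBased_zero] at this

theorem signedValue_ne {n : ℕ} (σ : SignedPerm n) {i : ℕ} (h : i < n) :
    signedValue σ i ≠ signedValue σ (i + 1) := by
  intro e
  rw [signedValue_eq, signedValue_eq] at e
  have h1 := value_nonneg σ.right i
  have h2 := value_nonneg σ.right (i + 1)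
  have := congrArg abs e
  apply value_ne σ.right h
  rw [abs_mul, abs_mul, abs_of_nonneg h1, abs_of_nonneg h2] at this
  have hu : ∀ u : ℤˣ, |(u : ℤ)| = 1 := fun u => by
    rcases Int.units_eq_one_or u with h | h <;> simp [h]
  simpa [hu] using this

theorem abs_signedValue_le {n : ℕ} (σ : SignedPerm n) (i : ℕ) : |signedValue σ i| ≤ n := by
  rw [signedValue_eq_oneBased]
  unfold oneBased
  split_ifs
  · exact abs_act_idVec_le σ _
  · simp

/-- The shift turning weakly increasing sequences with prescribed strict steps into strictly
increasing ones. -/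
def shift (D : Finset ℕ) (i : ℕ) : ℤ := i + 1 - (D.filter (· < i + 1)).card

/-- The shift grows by 1 at steps outside `D` and by 0 at steps in `D`, which are strict already. -/
theorem chamber_shift_iff {n : ℕ} (D : Finset ℕ) (b : Fin n → ℤ) :
    Chamber (fun i => b i + shift D i) ↔
      ∀ i < n, oneBased b i + (if i ∈ D then 1 else 0) ≤ oneBased b (i + 1) := by
  rw [chamber_iff_step]
  refine forall₂_congr fun i hi => ?_
  have hc : (D.filter (· < i + 1)).card = (D.filter (· < i)).card + if i ∈ D then 1 else 0 := by
    split_ifs with h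
    · rw [← Finset.card_insert_of_notMem (s := D.filter (· < i)) (a := i) (by simp)]
      congr 1
      ext j
      simp only [Finset.mem_filter, Finset.mem_insert]
      grind
    · congr 1
      ext j
      simp only [Finset.mem_filter]
      grind
  rw [oneBased_succ _ hi, oneBased_succ _ hi]
  have hL : oneBased (fun i : Fin n => b i + shift D i) i =
      oneBased b i + i - (D.filter (· < i)).card := by
    cases i with
    | zero => simp [oneBased_zero]
    | succ i =>
      rw [oneBased_succ _ (by omega), oneBased_succ _ (by omega)]
      simp only [shift]
      push_cast
      ring
  rw [hL]
  simp only [shift, hc]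
  split_ifs <;> push_cast <;> omega

/-- Letters of one parity are written `2b - δ`. The key compares them lexicographically, so equality
of consecutive letters is allowed exactly at non-descents. Step 0 compares with the letter 0, not
with `-δ`: for `δ = 1` it always requires `b ≥ 1`. -/
theorem chamber_key_iff {n : ℕ} (σ : SignedPerm n) (δ : ℤ) (hδ : δ = 0 ∨ δ = 1) (D : Finset ℕ)
    (hD : ∀ i < n, i ∈ D ↔ (i = 0 ∧ δ = 1) ∨ signedValue σ i > signedValue σ (i + 1))
    (b : Fin n → ℤ) :
    Chamber (fun i => (2 * n + 2) * (2 * b i - δ) + act σ (idVec n) i) ↔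
      ∀ i < n, oneBased b i + (if i ∈ D then 1 else 0) ≤ oneBased b (i + 1) := by
  rw [chamber_iff_step]
  refine forall₂_congr fun i hi => ?_
  -- The sign of `(2n+2)d + w` is lexicographic in `(d, w)` because `|w| ≤ 2n`.
  have key : ∀ d w : ℤ, |w| ≤ 2 * n → w ≠ 0 →
      (0 < (2 * n + 2) * d + w ↔ 0 < d ∨ d = 0 ∧ 0 < w) := by
    intro d w hw hw0
    have := abs_le.1 hw
    rcases lt_trichotomy d 0 with h | h | h
    · have := mul_le_mul_of_nonneg_left (show d + 1 ≤ 0 from h)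
        (show (0 : ℤ) ≤ 2 * n + 2 by positivity)
      constructor
      · intro; linarith
      · omega
    · subst h
      simp
    · have := mul_le_mul_of_nonneg_left (show 1 ≤ d from h)
        (show (0 : ℤ) ≤ 2 * n + 2 by positivity)
      constructor
      · omega
      · intro; linarith
  have hw1 := abs_le.1 (abs_signedValue_le σ i)
  have hw2 := abs_le.1 (abs_signedValue_le σ (i + 1))
  have hne := signedValue_ne σ hi
  have hDi := hD i hi
  have hstep := key (2 * oneBased b (i + 1) - δ - (if i = 0 then 0 else 2 * oneBased b i - δ))
    (signedValue σ (i + 1) - signedValue σ i) (by rw [abs_le]; omega) (by omega)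
  have hL : oneBased (fun i : Fin n => (2 * n + 2) * (2 * b i - δ) + act σ (idVec n) i) i =
      (2 * n + 2) * (if i = 0 then 0 else 2 * oneBased b i - δ) + signedValue σ i := by
    rw [signedValue_eq_oneBased]
    cases i with
    | zero => simp [oneBased_zero]
    | succ i =>
      rw [oneBased_succ _ (by omega), oneBased_succ _ (by omega), oneBased_succ _ (by omega),
        if_neg (by omega)]
  have hR : oneBased (fun i : Fin n => (2 * n + 2) * (2 * b i - δ) + act σ (idVec n) i) (i + 1) =
      (2 * n + 2) * (2 * oneBased b (i + 1) - δ) + signedValue σ (i + 1) := by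
    rw [signedValue_eq_oneBased, oneBased_succ _ hi, oneBased_succ _ hi, oneBased_succ _ hi]
  rw [hL, hR, ← sub_pos, show
    (2 * n + 2) * (2 * oneBased b (i + 1) - δ) + signedValue σ (i + 1) -
      ((2 * n + 2) * (if i = 0 then 0 else 2 * oneBased b i - δ) + signedValue σ i) =
    (2 * n + 2) * (2 * oneBased b (i + 1) - δ - (if i = 0 then 0 else 2 * oneBased b i - δ)) +
      (signedValue σ (i + 1) - signedValue σ i) by ring, hstep]
  have hb0 := oneBased_zero b
  by_cases h0 : i = 0
  · subst h0
    rw [hb0]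
    by_cases hi' : 0 ∈ D
    · have := hDi.1 hi'
      simp only [hi', if_true]
      omega
    · have := hDi.not.1 hi'
      simp only [hi', if_true, if_false]
      omega
  · by_cases hi' : i ∈ D
    · have := hDi.1 hi'
      simp only [hi', if_true, h0, if_false]
      omega
    · have := hDi.not.1 hi'
      simp only [hi', if_false, h0]
      omega

/-- Such words correspond to sequences `0 ≤ b_1 ≤ ⋯ ≤ b_n ≤ x` with strict steps at `D`; adding the
shift makes them strictly increasing sequences in `[1, x + n - |D|]`. -/
theorem card_std_eq {n : ℕ} (σ : SignedPerm n) (x m : ℕ) (δ : ℤ) (hδ : δ = 0 ∨ δ = 1)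
    (hm : (m : ℤ) = 2 * x + 1 - δ) (D : Finset ℕ) (hDn : D ⊆ Finset.range n)
    (hD : ∀ i < n, i ∈ D ↔ (i = 0 ∧ δ = 1) ∨ signedValue σ i > signedValue σ (i + 1)) :
    ((words n m).filter fun f => std f = σ).card = (x + (n - D.card)).choose n := by
  classical
  have hcard : D.card ≤ n := by simpa using Finset.card_le_card hDn
  have hact : ∀ f : Fin n → ℤ, act σ (key f) =
      fun i => (2 * n + 2) * act σ f i + act σ (idVec n) i := fun f => act_linear σ _ _ _
  rw [← card_bounded_chamber n (x + (n - D.card))]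
  symm
  refine Finset.card_bij (fun c _ => act σ⁻¹ fun i => 2 * (c i - shift D i) - δ) ?_ ?_ ?_
  · intro c hc
    rw [Finset.mem_filter, Fintype.mem_piFinset] at hc
    have hch : Chamber (fun i => (c i - shift D i) + shift D i) := by
      simp only [sub_add_cancel]
      exact ⟨hc.2, fun i => zero_lt_one.trans_le (Finset.mem_Icc.1 (hc.1 i)).1⟩
    have hs := (chamber_shift_iff D fun i => c i - shift D i).1 hch
    rw [Finset.mem_filter]
    refine ⟨?_, ?_⟩
    · apply act_mem_words
      rw [mem_words]
      intro i
      have hmono : ∀ i < n, oneBased (fun i => c i - shift D i) i ≤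
          oneBased (fun i => c i - shift D i) (i + 1) := fun i hi =>
        le_trans (by split_ifs <;> omega) (hs i hi)
      have h1 := le_of_forall_step hmono (Nat.le_add_left 1 (i : ℕ)) i.2
      have h2 := le_of_forall_step hmono (Nat.succ_le_of_lt i.2) le_rfl
      have hn : 0 < n := i.pos
      have h0 := hs 0 hn
      rw [zero_add] at h0
      rw [oneBased_zero] at h0
      have hlast : oneBased (fun i => c i - shift D i) n ≤ x := by
        obtain ⟨k, rfl⟩ : ∃ k, n = k + 1 := ⟨n - 1, by omega⟩
        rw [oneBased_succ _ (Nat.lt_succ_self k)]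
        have h3 := (Finset.mem_Icc.1 (hc.1 ⟨k, Nat.lt_succ_self k⟩)).2
        have h4 : D.filter (· < k + 1) = D :=
          Finset.filter_true_of_mem fun j hj => Finset.mem_range.1 (hDn hj)
        simp only [shift, h4]
        omega
      simp only [Nat.succ_eq_add_one] at h2
      rw [oneBased_succ _ i.2] at h1 h2
      simp only [Fin.eta] at h1 h2
      have hD0 := hD 0 hn
      have h5 : δ ≤ if 0 ∈ D then 1 else 0 := by
        rcases hδ with h | h
        · rw [h]; split_ifs <;> omega
        · rw [if_pos (hD0.2 (Or.inl ⟨rfl, h⟩)), h]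
      rw [mem_letters]
      -- The solution `a` of `2b - δ = 2a - m + 1` with `m = 2x + 1 - δ`.
      exact ⟨c i - shift D i + x - δ, by omega, by omega, by omega⟩
    · rw [std_eq_iff, hact, act_act_inv]
      exact (chamber_key_iff σ δ hδ D hD _).2 hs
  · intro c hc d hd h
    have := congrArg (act σ) h
    simp only [act_act_inv] at this
    funext i
    have := congrFun this i
    omega
  · intro f hf
    rw [Finset.mem_filter] at hf
    have hb : ∀ i, ∃ b : ℤ, act σ f i = 2 * b - δ ∧ b ≤ x := by
      intro i
      obtain ⟨a, h1, h2, h3⟩ := mem_letters.1 (mem_words.1 (act_mem_words σ hf.1) i)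
      exact ⟨a - x + δ, by omega, by omega⟩
    choose b hb hbx using hb
    have hch := (std_eq_iff f σ).1 hf.2
    rw [hact] at hch
    simp only [hb] at hch
    have hs := (chamber_key_iff σ δ hδ D hD b).1 hch
    have hc := (chamber_shift_iff D b).2 hs
    refine ⟨fun i => b i + shift D i, ?_, ?_⟩
    · rw [Finset.mem_filter, Fintype.mem_piFinset]
      refine ⟨fun i => ?_, hc.1⟩
      rw [Finset.mem_Icc]
      refine ⟨hc.2 i, ?_⟩
      obtain ⟨k, rfl⟩ : ∃ k, n = k + 1 := ⟨n - 1, by have := i.pos; omega⟩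
      refine (hc.1.monotone (Fin.le_last i)).trans ?_
      have h4 : D.filter (· < k + 1) = D :=
        Finset.filter_true_of_mem fun j hj => Finset.mem_range.1 (hDn hj)
      have h5 := hbx (Fin.last k)
      simp only [shift, Fin.val_last, h4]
      omega
    · rw [show (fun i => 2 * (b i + shift D i - shift D i) - δ) = act σ f by
        funext i
        rw [hb, add_sub_cancel_right], act_inv_act]

theorem card_std_eq_odd {n : ℕ} (σ : SignedPerm n) (x : ℕ) :
    ((words n (2 * x + 1)).filter fun f => std f = σ).card =
      (x + (n - (signedDes σ).card)).choose n := by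
  refine card_std_eq σ x _ 0 (Or.inl rfl) (by push_cast; ring) _ (Finset.filter_subset _ _) ?_
  intro i hi
  simp [signedDes, hi]

theorem card_std_eq_even {n : ℕ} (hn : 0 < n) (σ : SignedPerm n) (x : ℕ) :
    ((words n (2 * x)).filter fun f => std f = σ).card =
      (x + (n - ((signedDes σ \ {0}).card + 1))).choose n := by
  -- For an even alphabet 0 is not a letter, so step 0 is strict whether or not it is a descent.
  rw [card_std_eq σ x _ 1 (Or.inr rfl) (by push_cast; ring) (insert 0 (signedDes σ \ {0})) ?_ ?_,
    Finset.card_insert_of_notMem (by simp)]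
  · intro i hi
    simp only [signedDes, Finset.mem_insert, Finset.mem_sdiff, Finset.mem_filter] at hi
    rcases hi with rfl | hi
    · exact Finset.mem_range.2 hn
    · exact hi.1.1
  · intro i hi
    simp only [signedDes, Finset.mem_insert, Finset.mem_sdiff, Finset.mem_filter,
      Finset.mem_range, hi, Finset.mem_singleton]
    tauto

/-! ### Extension of product rules by polynomiality -/

/-- Functions on `ℚ` given by a polynomial. -/
def IsPoly (f : ℚ → ℚ) : Prop := ∃ p : Polynomial ℚ, ∀ x, f x = p.eval x

theorem IsPoly.const (c : ℚ) : IsPoly fun _ => c := ⟨Polynomial.C c, by simp⟩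

theorem IsPoly.id : IsPoly fun x => x := ⟨Polynomial.X, by simp⟩

theorem IsPoly.add {f g : ℚ → ℚ} : IsPoly f → IsPoly g → IsPoly fun x => f x + g x := by
  rintro ⟨p, hp⟩ ⟨q, hq⟩
  exact ⟨p + q, by simp [hp, hq]⟩

theorem IsPoly.mul {f g : ℚ → ℚ} : IsPoly f → IsPoly g → IsPoly fun x => f x * g x := by
  rintro ⟨p, hp⟩ ⟨q, hq⟩
  exact ⟨p * q, by simp [hp, hq]⟩

theorem IsPoly.comp {f g : ℚ → ℚ} : IsPoly f → IsPoly g → IsPoly fun x => f (g x) := by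
  rintro ⟨p, hp⟩ ⟨q, hq⟩
  exact ⟨p.comp q, by simp [hp, hq]⟩

theorem IsPoly.sum {ι : Type*} (s : Finset ι) {f : ι → ℚ → ℚ} (h : ∀ i, IsPoly (f i)) :
    IsPoly fun x => ∑ i ∈ s, f i x := by
  choose p hp using h
  exact ⟨∑ i ∈ s, p i, by simp [hp, Polynomial.eval_finsetSum]⟩

theorem IsPoly.prod {ι : Type*} (s : Finset ι) {f : ι → ℚ → ℚ} (h : ∀ i, IsPoly (f i)) :
    IsPoly fun x => ∏ i ∈ s, f i x := by
  choose p hp using h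
  exact ⟨∏ i ∈ s, p i, by simp [hp, Polynomial.eval_prod]⟩

theorem IsPoly.eq_of_nat {f g : ℚ → ℚ} (hf : IsPoly f) (hg : IsPoly g)
    (h : ∀ m : ℕ, f (m + 1) = g (m + 1)) (x : ℚ) : f x = g x := by
  obtain ⟨p, hp⟩ := hf
  obtain ⟨q, hq⟩ := hg
  rw [hp, hq]
  congr 1
  apply Polynomial.eq_of_infinite_eval_eq
  refine Set.infinite_of_injective_forall_mem (f := fun m : ℕ => (m + 1 : ℚ)) ?_ ?_
  · intro a b hab
    simpa using hab
  · intro m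
    rw [Set.mem_ofPred_eq, ← hp, ← hq, h]

/-- A multiplication rule between group algebra elements depending polynomially on a parameter
extends from the positive integers to all parameters. -/
theorem mul_rule_extend {G : Type*} [Fintype G] [Group G] (a : G → ℚ → ℚ)
    (ha : ∀ g, IsPoly (a g)) (r : ℚ → ℚ → ℚ) (c : ℚ) (h1 : ∀ y, IsPoly fun x => r x y)
    (h2 : ∀ x, IsPoly fun y => r x y)
    (h : ∀ x y : ℕ, (∑ g, a g (x + 1) • MonoidAlgebra.of ℚ G g) *
      (∑ g, a g (y + 1) • MonoidAlgebra.of ℚ G g) =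
      c • ∑ g, a g (r (x + 1) (y + 1)) • MonoidAlgebra.of ℚ G g) (x y : ℚ) :
    (∑ g, a g x • MonoidAlgebra.of ℚ G g) * (∑ g, a g y • MonoidAlgebra.of ℚ G g) =
      c • ∑ g, a g (r x y) • MonoidAlgebra.of ℚ G g := by
  let A : ℚ → MonoidAlgebra ℚ G := fun x => ∑ g, a g x • MonoidAlgebra.of ℚ G g
  change A x * A y = c • A (r x y)
  have hr : ∀ (ψ : ℚ → ℚ) (_ : IsPoly ψ) (g : G), IsPoly fun x => (c • A (ψ x)).coeff g := by
    intro ψ hψ g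
    have : ∀ x, (c • A (ψ x)).coeff g =
        c * ∑ t, a t (ψ x) * (MonoidAlgebra.of ℚ G t).coeff g := by
      intro x
      simp only [A, MonoidAlgebra.coeff_sum, Finsupp.finsetSum_apply,
        MonoidAlgebra.coeff_smul_apply, smul_eq_mul]
    simp only [this]
    exact (IsPoly.const c).mul (IsPoly.sum _ fun t => ((ha t).comp hψ).mul (IsPoly.const _))
  have hl : ∀ (B : MonoidAlgebra ℚ G) (g : G), IsPoly fun x => (A x * B).coeff g := by
    intro B g
    have : ∀ x, (A x * B).coeff g = ∑ t, a t x * (MonoidAlgebra.of ℚ G t * B).coeff g := by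
      intro x
      simp only [A, Finset.sum_mul, MonoidAlgebra.coeff_sum, Finsupp.finsetSum_apply,
        smul_mul_assoc, MonoidAlgebra.coeff_smul_apply, smul_eq_mul]
    simp only [this]
    exact IsPoly.sum _ fun t => (ha t).mul (IsPoly.const _)
  have hl' : ∀ (B : MonoidAlgebra ℚ G) (g : G), IsPoly fun x => (B * A x).coeff g := by
    intro B g
    have : ∀ x, (B * A x).coeff g = ∑ t, a t x * (B * MonoidAlgebra.of ℚ G t).coeff g := by
      intro x
      simp only [A, Finset.mul_sum, MonoidAlgebra.coeff_sum, Finsupp.finsetSum_apply,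
        mul_smul_comm, MonoidAlgebra.coeff_smul_apply, smul_eq_mul]
    simp only [this]
    exact IsPoly.sum _ fun t => (ha t).mul (IsPoly.const _)
  -- One variable at a time: coefficients are polynomial in each, and agree at infinitely many
  -- points.
  have step : ∀ (m : ℕ) (x : ℚ), A x * A (m + 1) = c • A (r x (m + 1)) := by
    intro m x
    ext g
    exact (hl _ g).eq_of_nat (hr _ (h1 _) g) (fun k => by rw [h]) x
  ext g
  exact (hl' _ g).eq_of_nat (hr _ (h2 _) g) (fun k => by rw [step]) y

/-- The polynomial function `x ↦ (x + N).choose n`. -/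
def binomial (n N : ℕ) (x : ℚ) : ℚ := (∏ i ∈ Finset.range n, (x + (N - i))) * (n ! : ℚ)⁻¹

theorem isPoly_binomial (n N : ℕ) : IsPoly (binomial n N) :=
  (IsPoly.prod _ fun _ => IsPoly.id.add (IsPoly.const _)).mul (IsPoly.const _)

theorem binomial_natCast (n N x : ℕ) : binomial n N x = ((x + N).choose n : ℕ) := by
  have h := descPochhammer_eval_eq_descFactorial ℚ (x + N) n
  rw [descPochhammer_eval_eq_prod_range, Nat.descFactorial_eq_factorial_mul_choose] at h
  have h0 : (n ! : ℚ) ≠ 0 := by exact_mod_cast n.factorial_ne_zero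
  unfold binomial
  rw [← div_eq_mul_inv, div_eq_iff h0]
  push_cast at h
  rw [mul_comm, ← h]
  exact Finset.prod_congr rfl fun i _ => by ring

theorem prod_range_sub_eq_factorial (c : ℕ) : ∏ i ∈ Finset.range c, ((c : ℚ) - i) = c ! := by
  induction c with
  | zero => simp
  | succ c ih =>
    rw [Finset.prod_range_succ', Nat.factorial_succ]
    push_cast
    rw [← ih, sub_zero, mul_comm]
    congr 1
    exact Finset.prod_congr rfl fun i _ => by ring

theorem prod_range_neg_succ (d : ℕ) :
    ∏ j ∈ Finset.range d, (-((j : ℚ) + 1)) = (-1) ^ d * d ! := by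
  induction d with
  | zero => simp
  | succ d ih =>
    rw [Finset.prod_range_succ, ih, Nat.factorial_succ]
    push_cast
    ring

theorem prod_range_sub_half (c : ℕ) :
    2 ^ c * ∏ i ∈ Finset.range c, (-1 / 2 + ((c : ℚ) - i)) = ((2 * c - 1)‼ : ℕ) := by
  induction c with
  | zero => simp
  | succ c ih =>
    rw [Finset.prod_range_succ', show 2 * (c + 1) - 1 = 2 * c + 1 by omega,
      doubleFactorial_add_one_eq]
    push_cast
    rw [← ih, Finset.prod_congr rfl fun (i : ℕ) _ => show
      (-1 / 2 + ((c : ℚ) + 1 - (i + 1))) = -1 / 2 + ((c : ℚ) - i) by ring]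
    ring

theorem prod_range_neg_half_sub (d : ℕ) :
    2 ^ d * ∏ j ∈ Finset.range d, (-1 / 2 - (j : ℚ)) = (-1) ^ d * ((2 * d - 1)‼ : ℕ) := by
  induction d with
  | zero => simp
  | succ d ih =>
    rw [Finset.prod_range_succ, show 2 * (d + 1) - 1 = 2 * d + 1 by omega,
      doubleFactorial_add_one_eq]
    push_cast
    linear_combination (-(2 * d + 1) : ℚ) * ih

theorem binomial_neg_half (c d : ℕ) : binomial (c + d) c (-1 / 2) =
    (-1) ^ d * ((2 * d - 1)‼ : ℕ) * ((2 * c - 1)‼ : ℕ) / ((2 * (c + d))‼ : ℕ) := by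
  unfold binomial
  rw [Finset.prod_range_add, ← prod_range_neg_half_sub, ← prod_range_sub_half c,
    Nat.doubleFactorial_two_mul, Finset.prod_congr rfl fun (j : ℕ) (_ : j ∈ Finset.range d) => show
      (-1 / 2 + ((c : ℚ) - (c + j : ℕ))) = -1 / 2 - j by push_cast; ring]
  have h0 : ((c + d)! : ℚ) ≠ 0 := by exact_mod_cast Nat.factorial_ne_zero _
  push_cast
  rw [pow_add]
  field_simp

/-- The quotient of `binomial (c + d + 1) c` by its root at `0`. -/
def reducedBinomial (c d : ℕ) (x : ℚ) : ℚ :=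
  ((∏ i ∈ Finset.range c, (x + ((c : ℚ) - i))) * ∏ j ∈ Finset.range d, (x + -((j : ℚ) + 1))) *
    ((c + d + 1)! : ℚ)⁻¹

theorem isPoly_reducedBinomial (c d : ℕ) : IsPoly (reducedBinomial c d) :=
  ((IsPoly.prod _ fun _ => IsPoly.id.add (IsPoly.const _)).mul
    (IsPoly.prod _ fun _ => IsPoly.id.add (IsPoly.const _))).mul (IsPoly.const _)

theorem binomial_eq_mul_reducedBinomial (c d : ℕ) (x : ℚ) :
    binomial (c + d + 1) c x = x * reducedBinomial c d x := by
  unfold binomial reducedBinomial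
  rw [add_assoc c d 1, Finset.prod_range_add, Finset.prod_range_succ',
    Finset.prod_congr rfl fun (j : ℕ) (_ : j ∈ Finset.range d) => show
      (x + ((c : ℚ) - (c + (j + 1) : ℕ))) = x + -((j : ℚ) + 1) by push_cast; ring]
  push_cast
  ring

theorem reducedBinomial_zero (c d : ℕ) :
    reducedBinomial c d 0 = (-1) ^ d * d ! * c ! / (c + d + 1)! := by
  unfold reducedBinomial
  simp only [zero_add]
  rw [prod_range_sub_eq_factorial, prod_range_neg_succ]
  ring

/-! ### The relations for `e` and `e0` over the rationals -/

theorem wordSum_eq (n m : ℕ) : wordSum n m = ∑ σ : SignedPerm n,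
    (((words n m).filter fun f => std f = σ).card : ℚ) • MonoidAlgebra.of ℚ (SignedPerm n) σ := by
  unfold wordSum
  rw [← Finset.sum_fiberwise (words n m) std]
  refine Finset.sum_congr rfl fun σ _ => ?_
  rw [Finset.sum_congr rfl fun f hf => by rw [(Finset.mem_filter.1 hf).2], Finset.sum_const,
    Nat.cast_smul_eq_nsmul]

theorem sum_smul_sum_fiber {G k : Type*} [Fintype G] [Monoid G] [Field k] (s : Finset ℕ)
    (t : G → ℕ) (ht : ∀ g, t g ∈ s) (c : ℕ → k) :
    ∑ j ∈ s, c j • ∑ g with t g = j, MonoidAlgebra.of k G g =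
      ∑ g, c (t g) • MonoidAlgebra.of k G g := by
  rw [← Finset.sum_fiberwise_of_maps_to (s := Finset.univ) (g := t) (t := s)
    (fun g _ => ht g)]
  refine Finset.sum_congr rfl fun j _ => ?_
  rw [Finset.smul_sum]
  exact Finset.sum_congr rfl fun g hg => by rw [(Finset.mem_filter.1 hg).2]

theorem e_eq (k : Type*) [Field k] (n : ℕ) : e k n = ∑ σ : SignedPerm n,
    ((-1 : k) ^ (signedDes σ).card * (((2 * (signedDes σ).card - 1)‼ : ℕ) : k) *
      (((2 * n - 2 * (signedDes σ).card - 1)‼ : ℕ) : k) / (((2 * n)‼ : ℕ) : k)) •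
      MonoidAlgebra.of k (SignedPerm n) σ :=
  sum_smul_sum_fiber _ (fun σ : SignedPerm n => (signedDes σ).card)
    (fun σ => Finset.mem_Icc.2 ⟨Nat.zero_le _, card_signedDes_le σ⟩) _

theorem e0_eq (k : Type*) [Field k] {n : ℕ} (hn : 0 < n) : e0 k n = ∑ σ : SignedPerm n,
    ((-1 : k) ^ (signedDes σ \ {0}).card * (((signedDes σ \ {0}).card ! : ℕ) : k) *
      (((n - 1 - (signedDes σ \ {0}).card)! : ℕ) : k) / ((n ! : ℕ) : k)) •
      MonoidAlgebra.of k (SignedPerm n) σ := by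
  refine (sum_smul_sum_fiber _ (fun σ : SignedPerm n => (signedDes σ \ {0}).card + 1)
    (fun σ => Finset.mem_Icc.2 ⟨Nat.le_add_left _ _, card_signedDes_sdiff_lt hn σ⟩) _).trans ?_
  refine Finset.sum_congr rfl fun σ _ => ?_
  rw [Nat.add_sub_cancel, Nat.sub_sub, Nat.add_comm 1]

theorem e_mul_self (n : ℕ) : e ℚ n * e ℚ n = e ℚ n := by
  have he : e ℚ n = ∑ σ : SignedPerm n, binomial n (n - (signedDes σ).card) (-1 / 2) •
      MonoidAlgebra.of ℚ (SignedPerm n) σ := by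
    rw [e_eq]
    refine Finset.sum_congr rfl fun σ _ => ?_
    obtain ⟨c, hc⟩ := Nat.exists_eq_add_of_le' (card_signedDes_le σ)
    have := binomial_neg_half c (signedDes σ).card
    rw [← hc] at this
    rw [show n - (signedDes σ).card = c by omega, this,
      show 2 * n - 2 * (signedDes σ).card - 1 = 2 * c - 1 by omega]
  have hw : ∀ x : ℕ, wordSum n (2 * x + 1) = ∑ σ : SignedPerm n,
      binomial n (n - (signedDes σ).card) x • MonoidAlgebra.of ℚ (SignedPerm n) σ := by
    intro x
    rw [wordSum_eq]
    refine Finset.sum_congr rfl fun σ _ => ?_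
    rw [card_std_eq_odd, binomial_natCast]
  -- The rule is `(2x+1)(2y+1) = 2(2xy+x+y) + 1`; the parameter `-1/2` makes each alphabet size 0,
  -- and `0 * 0 = 0`.
  have := mul_rule_extend (fun σ : SignedPerm n => binomial n (n - (signedDes σ).card))
    (fun σ => isPoly_binomial _ _) (fun x y => 2 * x * y + x + y) 1
    (fun y => ((((IsPoly.const 2).mul IsPoly.id).mul (IsPoly.const y)).add IsPoly.id).add
      (IsPoly.const y))
    (fun x => (((IsPoly.const (2 * x)).mul IsPoly.id).add (IsPoly.const x)).add IsPoly.id)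
    (fun x y => by
      have h := wordSum_mul n (2 * (x + 1) + 1) (2 * (y + 1) + 1)
      rw [show (2 * (x + 1) + 1) * (2 * (y + 1) + 1) =
        2 * (2 * (x + 1) * (y + 1) + (x + 1) + (y + 1)) + 1 by ring, hw, hw, hw] at h
      push_cast at h
      rw [one_smul]
      exact h) (-1 / 2) (-1 / 2)
  rw [he, this, one_smul]
  norm_num

theorem e0_mul_self {n : ℕ} (hn : 0 < n) : e0 ℚ n * e0 ℚ n = (2 : ℚ) • e0 ℚ n := by
  have he : e0 ℚ n = ∑ σ : SignedPerm n,
      reducedBinomial (n - 1 - (signedDes σ \ {0}).card) (signedDes σ \ {0}).card 0 •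
      MonoidAlgebra.of ℚ (SignedPerm n) σ := by
    rw [e0_eq ℚ hn]
    refine Finset.sum_congr rfl fun σ _ => ?_
    have := card_signedDes_sdiff_lt hn σ
    rw [reducedBinomial_zero, show n - 1 - (signedDes σ \ {0}).card + (signedDes σ \ {0}).card + 1
      = n by omega]
  have hw : ∀ x : ℕ, wordSum n (2 * x) = (x : ℚ) • ∑ σ : SignedPerm n,
      reducedBinomial (n - 1 - (signedDes σ \ {0}).card) (signedDes σ \ {0}).card x •
        MonoidAlgebra.of ℚ (SignedPerm n) σ := by
    intro x
    rw [wordSum_eq, Finset.smul_sum]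
    refine Finset.sum_congr rfl fun σ _ => ?_
    have hd := card_signedDes_sdiff_lt hn σ
    have := binomial_eq_mul_reducedBinomial (n - 1 - (signedDes σ \ {0}).card)
      (signedDes σ \ {0}).card x
    rw [show n - 1 - (signedDes σ \ {0}).card + (signedDes σ \ {0}).card + 1
      = n by omega] at this
    rw [card_std_eq_even hn, smul_smul, ← this, ← binomial_natCast,
      Nat.sub_sub, Nat.add_comm 1]
  have := mul_rule_extend (fun σ : SignedPerm n =>
      reducedBinomial (n - 1 - (signedDes σ \ {0}).card) (signedDes σ \ {0}).card)
    (fun σ => isPoly_reducedBinomial _ _) (fun x y => 2 * x * y) 2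
    (fun y => ((IsPoly.const 2).mul IsPoly.id).mul (IsPoly.const y))
    (fun x => (IsPoly.const (2 * x)).mul IsPoly.id)
    (fun x y => by
      have h := wordSum_mul n (2 * (x + 1)) (2 * (y + 1))
      rw [show (2 * (x + 1)) * (2 * (y + 1)) = 2 * (2 * (x + 1) * (y + 1)) by ring, hw, hw,
        hw, smul_mul_smul_comm] at h
      push_cast at h
      -- The rule reads `xy E(x) E(y) = 2xy E(2xy)`. Cancelling `xy` needs positive integers, but
      -- the result extends to 0.
      have h0 : ((x + 1) * (y + 1) : ℚ) ≠ 0 := by positivity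
      refine smul_right_injective _ h0 ?_
      simp only
      rw [h, smul_smul]
      congr 1
      ring) 0 0
  rw [he, this]
  norm_num

/-! ### Forgetting signs -/

theorem forgetSigns_sum (k : Type*) [Field k] (n : ℕ) (c : SignedPerm n → k) :
    forgetSigns k n (∑ σ, c σ • MonoidAlgebra.of k (SignedPerm n) σ) =
      ∑ π : Equiv.Perm (Fin n), (∑ ε : Fin n → ℤˣ, c ⟨ε, π⟩) •
        MonoidAlgebra.of k (Equiv.Perm (Fin n)) π := by
  have h : ∀ σ : SignedPerm n, forgetSigns k n (MonoidAlgebra.of k (SignedPerm n) σ) =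
      MonoidAlgebra.of k (Equiv.Perm (Fin n)) σ.right := by
    intro σ
    simp [forgetSigns, MonoidAlgebra.of_apply]
  simp only [map_sum, map_smul, h, Finset.sum_smul]
  rw [← Fintype.sum_prod_type_right fun x : (Fin n → ℤˣ) × Equiv.Perm (Fin n) =>
    c ⟨x.1, x.2⟩ • MonoidAlgebra.of k (Equiv.Perm (Fin n)) x.2]
  exact Fintype.sum_equiv SemidirectProduct.equivProd _ _ fun _ => rfl

theorem rho_eq (k : Type*) [Field k] (n : ℕ) : rho k n = ∑ π : Equiv.Perm (Fin n),
    ((-1 : k) ^ (peakSet π).card * (((2 * (peakSet π).card - 1)‼ : ℕ) : k) *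
      (((n - 2 * (peakSet π).card - 1)‼ : ℕ) : k) / ((n‼ : ℕ) : k)) •
      MonoidAlgebra.of k (Equiv.Perm (Fin n)) π :=
  sum_smul_sum_fiber _ (fun π : Equiv.Perm (Fin n) => (peakSet π).card)
    (fun π => Finset.mem_Icc.2 ⟨Nat.zero_le _, by
      obtain ⟨r, hr, -⟩ := sum_descents (0 : ℤ) 0 π
      omega⟩) _

theorem rho0_eq (k : Type*) [Field k] {n : ℕ} (hn : 0 < n) :
    rho0 k n = ∑ π : Equiv.Perm (Fin n),
    ((-1 : k) ^ (peakSet π \ {1}).card * (((2 * (peakSet π \ {1}).card)‼ : ℕ) : k) *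
      (((n - 2 * (peakSet π \ {1}).card - 2)‼ : ℕ) : k) / ((n‼ : ℕ) : k)) •
      MonoidAlgebra.of k (Equiv.Perm (Fin n)) π := by
  refine (sum_smul_sum_fiber _ (fun π : Equiv.Perm (Fin n) => (peakSet π \ {1}).card + 1)
    (fun π => Finset.mem_Icc.2 ⟨Nat.le_add_left _ _, by
      obtain ⟨r, hr, -⟩ := sum_descents_sdiff_zero (0 : ℤ) 0 hn π
      omega⟩) _).trans ?_
  refine Finset.sum_congr rfl fun π _ => ?_
  rw [Nat.add_sub_cancel, Nat.mul_add, Nat.mul_one, Nat.add_sub_cancel, Nat.sub_add_eq]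

theorem doubleFactorial_dvd_factorial (n : ℕ) : n‼ ∣ n ! := by
  cases n with
  | zero => simp
  | succ n => exact ⟨_, Nat.factorial_eq_mul_doubleFactorial n⟩

theorem cast_ne_zero_of_dvd {k : Type*} [Field k] {a b : ℕ} (h : a ∣ b) (hb : (b : k) ≠ 0) :
    (a : k) ≠ 0 := by
  rintro ha
  obtain ⟨c, rfl⟩ := h
  rw [Nat.cast_mul, ha, zero_mul] at hb
  exact hb rfl

theorem forgetSigns_e (k : Type*) [Field k] (n : ℕ) (h : (((2 * n)‼ : ℕ) : k) ≠ 0) :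
    forgetSigns k n (e k n) = if Even n then rho k n else 0 := by
  have hn : ((n‼ : ℕ) : k) ≠ 0 := by
    refine cast_ne_zero_of_dvd ((doubleFactorial_dvd_factorial n).trans ?_) h
    rw [Nat.doubleFactorial_two_mul]
    exact dvd_mul_left _ _
  have hs : ∀ π : Equiv.Perm (Fin n), ∑ ε : Fin n → ℤˣ,
      ((-1 : k) ^ (signedDes ⟨ε, π⟩).card * (((2 * (signedDes ⟨ε, π⟩).card - 1)‼ : ℕ) : k) *
      (((2 * n - 2 * (signedDes ⟨ε, π⟩).card - 1)‼ : ℕ) : k) / (((2 * n)‼ : ℕ) : k)) =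
      (if Even n then (-1 : k) ^ (peakSet π).card * ((2 * (peakSet π).card - 1)‼ : ℕ) *
        ((n - 2 * (peakSet π).card - 1)‼ : ℕ) else 0) / ((n‼ : ℕ) : k) := by
    intro π
    have := congrArg (Int.cast : ℤ → k) (sum_doubleFactorial_descents π)
    push_cast at this
    rw [← Finset.sum_div, div_eq_div_iff h hn, mul_comm, this, mul_comm]
  rw [e_eq, forgetSigns_sum, Finset.sum_congr rfl fun π _ => by rw [hs π]]
  split_ifs
  · rw [rho_eq]
  · simp

theorem forgetSigns_e0 (k : Type*) [Field k] {n : ℕ} (hn0 : 0 < n) (h : ((n ! : ℕ) : k) ≠ 0) :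
    forgetSigns k n (e0 k n) = if Even n then 0 else (2 : k) • rho0 k n := by
  have hn : ((n‼ : ℕ) : k) ≠ 0 := cast_ne_zero_of_dvd (doubleFactorial_dvd_factorial n) h
  have hs : ∀ π : Equiv.Perm (Fin n), ∑ ε : Fin n → ℤˣ,
      ((-1 : k) ^ (signedDes ⟨ε, π⟩ \ {0}).card * (((signedDes ⟨ε, π⟩ \ {0}).card ! : ℕ) : k) *
      (((n - 1 - (signedDes ⟨ε, π⟩ \ {0}).card)! : ℕ) : k) / ((n ! : ℕ) : k)) =
      (if Even n then 0 else 2 * ((-1 : k) ^ (peakSet π \ {1}).card *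
        ((2 * (peakSet π \ {1}).card)‼ : ℕ) * ((n - 2 * (peakSet π \ {1}).card - 2)‼ : ℕ))) /
        ((n‼ : ℕ) : k) := by
    intro π
    have := congrArg (Int.cast : ℤ → k) (sum_factorial_descents hn0 π)
    push_cast at this
    rw [← Finset.sum_div, div_eq_div_iff h hn, mul_comm, this, mul_comm]
  rw [e0_eq k hn0, forgetSigns_sum, Finset.sum_congr rfl fun π _ => by rw [hs π]]
  split_ifs
  · simp
  · rw [rho0_eq k hn0, Finset.smul_sum]
    simp only [smul_smul, mul_div_assoc]

/-! ### Transfer of idempotency from the rationals to `k` -/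

theorem map_sum_single_int {G : Type*} [Fintype G] [Group G] (R : G → ℤ) (N : ℕ)
    (F : Type*) [Field F] (hF : (N : F) ≠ 0) :
    MonoidAlgebra.mapRingHom G (Int.castRingHom F) (∑ g, MonoidAlgebra.single g (R g)) =
      (N : F) • ∑ g, ((R g : F) / (N : F)) • MonoidAlgebra.of F G g := by
  rw [map_sum, Finset.smul_sum]
  refine Finset.sum_congr rfl fun g _ => ?_
  rw [MonoidAlgebra.mapRingHom_single, smul_smul, mul_div_cancel₀ _ hF,
    MonoidAlgebra.of_apply, MonoidAlgebra.smul_single, smul_eq_mul, mul_one]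
  rfl

/-- Idempotency of an element with numerators `R` and common denominator `N` descends from `ℚ`
to every field in which `N` is nonzero. -/
theorem isIdempotentElem_of_rat {G : Type*} [Fintype G] [Group G] (R : G → ℤ) (N : ℕ)
    (k : Type*) [Field k] (hN : (N : k) ≠ 0)
    (h : IsIdempotentElem (∑ g, ((R g : ℚ) / (N : ℚ)) • MonoidAlgebra.of ℚ G g)) :
    IsIdempotentElem (∑ g, ((R g : k) / (N : k)) • MonoidAlgebra.of k G g) := by
  set A : MonoidAlgebra ℤ G := ∑ g, MonoidAlgebra.single g (R g) with hAdef
  have hQ : (N : ℚ) ≠ 0 := by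
    rintro h0
    rw [Nat.cast_eq_zero.1 h0, Nat.cast_zero] at hN
    exact hN rfl
  -- Idempotency of `A / N` is an integral relation for `A`; it holds in the integral group ring,
  -- which embeds in the rational one, and can then be reduced to `k`.
  have hA : A * A = (N : ℤ) • A := by
    have hinj : Function.Injective (MonoidAlgebra.mapRingHom G (Int.castRingHom ℚ)) := by
      intro a b hab
      ext g
      have := congrArg (fun x => x.coeff g) hab
      simpa [MonoidAlgebra.coeff_mapRingHom] using this
    apply hinj
    rw [map_mul, map_zsmul, hAdef, map_sum_single_int R N ℚ hQ, smul_mul_smul_comm, h.eq, ← Int.cast_smul_eq_zsmul ℚ,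
      smul_smul, Int.cast_natCast]
  have hk := congrArg (MonoidAlgebra.mapRingHom G (Int.castRingHom k)) hA
  rw [map_mul, map_zsmul, hAdef, map_sum_single_int R N k hN, smul_mul_smul_comm, ← Int.cast_smul_eq_zsmul k, smul_smul,
    Int.cast_natCast] at hk
  exact smul_right_injective _ (mul_ne_zero hN hN) hk

theorem isIdempotentElem_rho (k : Type*) [Field k] {n : ℕ} (hn : Even n)
    (h : ((n‼ : ℕ) : k) ≠ 0) : IsIdempotentElem (rho k n) := by
  have hQ : IsIdempotentElem (rho ℚ n) := by
    have h1 := forgetSigns_e ℚ n (by exact_mod_cast (Nat.doubleFactorial_pos _).ne')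
    rw [if_pos hn] at h1
    rw [← h1]
    exact IsIdempotentElem.map (e_mul_self n) (forgetSigns ℚ n)
  have := isIdempotentElem_of_rat (fun π : Equiv.Perm (Fin n) => (-1) ^ (peakSet π).card *
    ((2 * (peakSet π).card - 1)‼ : ℕ) * ((n - 2 * (peakSet π).card - 1)‼ : ℕ)) (n‼) k h
    (by push_cast; rw [← rho_eq]; exact hQ)
  push_cast at this
  rwa [← rho_eq] at this

theorem isIdempotentElem_rho0 (k : Type*) [Field k] {n : ℕ} (hn : Odd n)
    (h : ((n‼ : ℕ) : k) ≠ 0) : IsIdempotentElem (rho0 k n) := by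
  have hn0 : 0 < n := hn.pos
  have hQ : IsIdempotentElem (rho0 ℚ n) := by
    have h1 := forgetSigns_e0 ℚ hn0 (by exact_mod_cast n.factorial_ne_zero)
    rw [if_neg (Nat.not_even_iff_odd.2 hn)] at h1
    -- Since `e0` maps to `2 rho0`, the relation `e0² = 2 e0` becomes `4 rho0² = 4 rho0`.
    have h2 := congrArg (forgetSigns ℚ n) (e0_mul_self hn0)
    rw [map_mul, map_smul, h1, smul_mul_smul_comm, smul_smul] at h2
    exact smul_right_injective _ (by norm_num) h2
  have := isIdempotentElem_of_rat (fun π : Equiv.Perm (Fin n) => (-1) ^ (peakSet π \ {1}).card *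
    ((2 * (peakSet π \ {1}).card)‼ : ℕ) * ((n - 2 * (peakSet π \ {1}).card - 2)‼ : ℕ)) (n‼) k h
    (by push_cast; rw [← rho0_eq ℚ hn0]; exact hQ)
  push_cast at this
  rwa [← rho0_eq k hn0] at this

end PeakAlgebra

theorem theorem5p2 {k : Type*} [Field k] (h2 : (2 : k) ≠ 0) (n : ℕ) (hn : 0 < n) :
    ((((2 * n)‼ : ℕ) : k) ≠ 0 →
      (Even n → PeakAlgebra.forgetSigns k n (PeakAlgebra.e k n) = PeakAlgebra.rho k n) ∧
      (Odd n → PeakAlgebra.forgetSigns k n (PeakAlgebra.e k n) = 0)) ∧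
    (((n ! : ℕ) : k) ≠ 0 →
      (Even n → PeakAlgebra.forgetSigns k n (PeakAlgebra.e0 k n) = 0) ∧
      (Odd n → PeakAlgebra.forgetSigns k n (PeakAlgebra.e0 k n)
        = (2 : k) • PeakAlgebra.rho0 k n)) ∧
    (((n‼ : ℕ) : k) ≠ 0 →
      (Even n → IsIdempotentElem (PeakAlgebra.rho k n)) ∧
      (Odd n → IsIdempotentElem (PeakAlgebra.rho0 k n))) := by
  refine ⟨fun h => ⟨fun he => ?_, fun ho => ?_⟩, fun h => ⟨fun he => ?_, fun ho => ?_⟩,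
    fun h => ⟨fun he => PeakAlgebra.isIdempotentElem_rho k he h,
      fun ho => PeakAlgebra.isIdempotentElem_rho0 k ho h⟩⟩
  · rw [PeakAlgebra.forgetSigns_e k n h, if_pos he]
  · rw [PeakAlgebra.forgetSigns_e k n h, if_neg (Nat.not_even_iff_odd.2 ho)]
  · rw [PeakAlgebra.forgetSigns_e0 k hn h, if_pos he]
  · rw [PeakAlgebra.forgetSigns_e0 k hn h, if_neg (Nat.not_even_iff_odd.2 ho)]
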